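/- Let $K$ be a field, complete with respect to an ultrametric norm $|\cdot|$, whose residue field is infinite and whose value group $|K^*|\subset\mathbb{R}_{>0}$ is not discrete. *The Berkovich projective line.* Write $\mathbb{P}^1_K=K\sqcup\{\infty\}$. An open ball of $\mathbb{P}^1_K$ is a set $\{z\in K:|z-a|<r\}$, or the complement in $\mathbb{P}^1_K$ of a set $\{z\in K:|z-a|\le r\}$, with $a\in K$ and $r\in|K^*|$; an open affinoid is a finite intersection of open balls. The sets $\bigcup_{Y\in C}Y\times Y$, where $C$ runs over the finite covers of $\mathbb{P}^1_K$ by open affinoids, form a base of a uniform structure on $\mathbb{P}^1_K$. Its separated completion $\mathsf{P}^1_K$ (whose points are the minimal Cauchy filters on $\mathbb{P}^1_K$) is the Berkovich projective line; the topology of this completion is the *weak topology*. *The tree.* Let $\mathcal{A}_K$ be the completion of the space of points $[x,r]$ ($x\in K$, $r\ge 0$, with $[x,r]=[x',r']$ if and only if $r=r'\ge|x-x'|$) for the distance $\delta([x,r],[x',r'])=\max\{r,r',|x-x'|\}-\tfrac12(r+r')$. Let $\operatorname{diam}$, $|\cdot|$ and $\sup\{\cdot,\cdot\}$ be the continuous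 extensions to $\mathcal{A}_K$ of $\operatorname{diam}[x,r]=r$, $|[x,r]|=\max\{|x|,r\}$ and $\sup\{[x,r],[x',r']\}=\max\{r,r',|x-x'|\}$. The set $\mathcal{A}'_K=\mathcal{A}_K\sqcup\{\infty\}$, with the distance $$\Delta(S,T)=\frac{\sup\{S,T\}}{\max\{1,|S|\}\max\{1,|T|\}}-\frac{\operatorname{diam}S}{2\max\{1,|S|\}^2}-\frac{\operatorname{diam}T}{2\max\{1,|T|\}^2}\qquad(S,T\in\mathcal{A}_K),$$ $$\Delta(S,\infty)=\frac{1}{\max\{1,|S|\}}-\frac{\operatorname{diam}S}{2\max\{1,|S|\}^2},$$ is a real tree. *The identification.* Let $\iota:\mathcal{A}'_K\to\mathsf{P}^1_K$ be the map that sends $S$ to the minimal Cauchy filter coarser than the Cauchy filter generated by the open balls of $\mathbb{P}^1_K$ whose corresponding open ball of $\mathcal{A}'_K$ contains $S$. Here $\{z:|z-a|<r\}$ corresponds to $\{S\in\mathcal{A}_K:\sup\{S,a\}<r\}$, and the complement of $\{z:|z-a|\le r\}$ corresponds to the complement of $\{S\in\mathcal{A}_K:\sup\{S,a\}\le r\}$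 (with $a=[a,0]$). It is the unique continuous map that sends each $[a,r]$ with $r>0$ to the minimal Cauchy filter $\mathfrak{F}$ for which the intersection of the balls of $K$ belonging to $\mathfrak{F}$ is $\{z:|z-a|\le r\}$; it is a bijection, by which $\mathcal{A}'_K$ and $\mathsf{P}^1_K$ are identified. The *fine topology* on $\mathsf{P}^1_K$ is the topology of $(\mathcal{A}'_K,\Delta)$ transported by $\iota$, the *geodesic segments* of $\mathsf{P}^1_K$ are the images by $\iota$ of the geodesic segments $[S,T]$ of the real tree $(\mathcal{A}'_K,\Delta)$, and a subset of $\mathsf{P}^1_K$ is *convex* if it contains the geodesic segment joining any two of its points. **Corollary.** The weak topology and the fine topology induce the same topology on every geodesic segment of $\mathsf{P}^1_K$. Consequently, for a subset $V\subset\mathsf{P}^1_K$ the following are equivalent: 1. $V$ is convex; 2. $V$ is connected for the fine topology; 3. $V$ is connected for the weak topology. In particular, for each of the two topologies, every connected subset of $\mathsf{P}^1_K$ is arc-connected (any two distinct points of it are joined by a topological arc contained in it), and every intersection of connected subsets of $\mathsf{P}^1_K$ is connected. (The empty set is regarded as connected.) -/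

import Mathlib

namespace BerkovichLine

open Set Filter Topology UniformSpace

/-! ## The tree of an ultrametric field -/

/-- Pairs `(x, r)` with `x ∈ K` and `r ≥ 0`, standing for the ball `{z | ‖z - x‖ ≤ r}`. -/
structure BallPair (K : Type*) where
  center : K
  radius : ℝ
  radius_nonneg : 0 ≤ radius

section Tree

variable {K : Type*} [NormedField K]

/-- `sup {[x, r], [x', r']} = max {r, r', ‖x - x'‖}`. -/
noncomputable def BallPair.sup (p q : BallPair K) : ℝ :=
  max (max p.radius q.radius) ‖p.center - q.center‖

theorem BallPair.sup_self (p : BallPair K) : p.sup p = p.radius := by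
  simp [BallPair.sup, p.radius_nonneg]

theorem BallPair.sup_comm (p q : BallPair K) : p.sup q = q.sup p := by
  simp only [BallPair.sup, norm_sub_rev p.center, max_comm p.radius]

variable [IsUltrametricDist K]

theorem BallPair.sup_triangle (p q s : BallPair K) : p.sup s ≤ max (p.sup q) (q.sup s) := by
  have h : ‖p.center - s.center‖ ≤ max ‖p.center - q.center‖ ‖q.center - s.center‖ := by
    simpa using IsUltrametricDist.norm_add_le_max (p.center - q.center) (q.center - s.center)
  refine max_le (max_le ?_ ?_) (h.trans (max_le_max (le_max_right _ _) (le_max_right _ _)))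
  · exact le_max_of_le_left ((le_max_left _ _).trans (le_max_left _ _))
  · exact le_max_of_le_right ((le_max_right _ _).trans (le_max_left _ _))

/-- The distance `δ([x, r], [x', r']) = max {r, r', ‖x - x'‖} - (r + r') / 2`.
Two pairs are at distance `0` if and only if `r = r' ≥ ‖x - x'‖`. -/
noncomputable instance : PseudoMetricSpace (BallPair K) where
  dist p q := p.sup q - (p.radius + q.radius) / 2
  dist_self p := by simp [BallPair.sup_self]
  dist_comm p q := by rw [BallPair.sup_comm, add_comm p.radius]
  dist_triangle p q s := by
    have h1 : q.radius ≤ p.sup q := (le_max_right _ _).trans (le_max_left _ _)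
    have h2 : q.radius ≤ q.sup s := (le_max_left _ _).trans (le_max_left _ _)
    rcases le_max_iff.1 (BallPair.sup_triangle p q s) with h | h <;> linarith

theorem BallPair.dist_def (p q : BallPair K) :
    dist p q = p.sup q - (p.radius + q.radius) / 2 := rfl

theorem BallPair.dist_eq_zero_iff (p q : BallPair K) :
    dist p q = 0 ↔ p.radius = q.radius ∧ ‖p.center - q.center‖ ≤ p.radius := by
  have h1 : p.radius ≤ p.sup q := (le_max_left _ _).trans (le_max_left _ _)
  have h2 : q.radius ≤ p.sup q := (le_max_right _ _).trans (le_max_left _ _)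
  have h3 : ‖p.center - q.center‖ ≤ p.sup q := le_max_right _ _
  rw [BallPair.dist_def]
  constructor
  · intro h
    constructor <;> linarith
  · rintro ⟨h, h'⟩
    have : p.sup q = p.radius := le_antisymm (by simp [BallPair.sup, h', ← h]) h1
    linarith

/-- The real tree `𝒜_K`: the completion, for the distance `δ`, of the space of the points `[x, r]`,
that is, of the pairs `(x, r)` modulo `r = r' ≥ ‖x - x'‖` (the completion of a pseudometric space
identifies the points that are at distance `0`). -/
abbrev Tree (K : Type*) [NormedField K] [IsUltrametricDist K] : Type _ :=
  Completion (BallPair K)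

namespace Tree

/-- The point `[x, r]` of the tree. -/
noncomputable def mk (x : K) (r : ℝ) (hr : 0 ≤ r) : Tree K :=
  ((⟨x, r, hr⟩ : BallPair K) : Completion (BallPair K))

/-- The point `[x, 0]` of the tree, identified with `x ∈ K`. -/
noncomputable def ofField (x : K) : Tree K := mk x 0 le_rfl

/-- The continuous extension of `diam [x, r] = r` to the tree. -/
noncomputable def diam : Tree K → ℝ :=
  Completion.extension (fun p : BallPair K => p.radius)

/-- The continuous extension of `sup {[x, r], [x', r']} = max {r, r', ‖x - x'‖}` to the tree. It
satisfies `δ(S, T) = sup {S, T} - (diam S + diam T) / 2`. -/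
noncomputable def sup (S T : Tree K) : ℝ := dist S T + (diam S + diam T) / 2

/-- The continuous extension of `|[x, r]| = max {‖x‖, r}` to the tree. -/
noncomputable def abs (S : Tree K) : ℝ := sup S (ofField 0)

theorem uniformContinuous_radius : UniformContinuous (fun p : BallPair K => p.radius) := by
  refine LipschitzWith.uniformContinuous (K := 2) (LipschitzWith.of_dist_le_mul fun p q => ?_)
  have h1 : p.radius ≤ p.sup q := (le_max_left _ _).trans (le_max_left _ _)
  have h2 : q.radius ≤ p.sup q := (le_max_right _ _).trans (le_max_left _ _)
  rw [Real.dist_eq, BallPair.dist_def, abs_le]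
  constructor <;> push_cast <;> linarith

@[fun_prop]
theorem continuous_diam : Continuous (diam : Tree K → ℝ) := Completion.continuous_extension

theorem diam_coe (p : BallPair K) : diam (p : Tree K) = p.radius :=
  Completion.extension_coe uniformContinuous_radius p

theorem sup_coe (p q : BallPair K) : sup (p : Tree K) (q : Tree K) = p.sup q := by
  rw [sup, diam_coe, diam_coe, Completion.dist_eq, BallPair.dist_def]
  ring

theorem abs_mk (x : K) (r : ℝ) (hr : 0 ≤ r) : abs (mk x r hr) = max ‖x‖ r := by
  rw [abs, ofField, mk, mk, sup_coe]
  simp [BallPair.sup, hr, max_comm]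

@[fun_prop]
theorem continuous_sup {X : Type*} [TopologicalSpace X] {f g : X → Tree K} (hf : Continuous f)
    (hg : Continuous g) : Continuous fun x => sup (f x) (g x) := by
  unfold sup
  fun_prop

@[fun_prop]
theorem continuous_abs : Continuous (abs : Tree K → ℝ) := by
  unfold abs
  fun_prop

theorem sup_self (S : Tree K) : sup S S = diam S := by simp [sup]

theorem sup_comm (S T : Tree K) : sup S T = sup T S := by
  rw [sup, sup, dist_comm, add_comm (diam S)]

theorem diam_nonneg (S : Tree K) : 0 ≤ diam S := by
  refine Completion.induction_on S (isClosed_le continuous_const continuous_diam) fun p => ?_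
  rw [diam_coe]
  exact p.radius_nonneg

theorem sup_triangle (S T U : Tree K) : sup S U ≤ max (sup S T) (sup T U) := by
  refine Completion.induction_on₃ S T U (isClosed_le (by fun_prop) (by fun_prop)) fun p q s => ?_
  simp only [sup_coe]
  exact BallPair.sup_triangle p q s

theorem diam_le_sup (S T : Tree K) : diam S ≤ sup S T := by
  have := sup_triangle S T S
  rwa [sup_comm T S, max_self, sup_self] at this

theorem max_one_abs (S : Tree K) : max 1 (abs S) = sup S (mk 0 1 zero_le_one) := by
  refine Completion.induction_on S (isClosed_eq (by fun_prop) (by fun_prop)) fun p => ?_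
  rw [abs, ofField, mk, mk, sup_coe, sup_coe]
  simp only [BallPair.sup, max_eq_left p.radius_nonneg, max_assoc]
  exact max_left_comm _ _ _

/-- The ultrametric four-point inequality. -/
theorem sup_mul_sup_le (S T U V : Tree K) :
    sup S U * sup T V ≤ max (sup S T * sup U V) (sup T U * sup S V) := by
  have nn : ∀ A B : Tree K, 0 ≤ sup A B := fun A B => (diam_nonneg A).trans (diam_le_sup A B)
  have h1 := sup_triangle S T U
  have h2 := sup_triangle T U V
  have h3 := sup_triangle T S V
  have h4 := sup_triangle S V U
  rw [sup_comm T S] at h3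
  rw [sup_comm V U] at h4
  have := nn S U
  have := nn T V
  have := nn S T
  have := nn U V
  have := nn T U
  have := nn S V
  simp only [le_max_iff] at h1 h2 h3 h4 ⊢
  rcases h1 with h1 | h1
  · rcases h2 with h2 | h2
    · rcases h3 with h3 | h3
      · rcases h4 with h4 | h4
        · right; calc
            _ ≤ sup S V * sup T U := by gcongr
            _ = _ := mul_comm _ _
        · left; calc
            _ ≤ sup U V * sup S T := by gcongr
            _ = _ := mul_comm _ _
      · rcases h4 with h4 | h4
        · right; calc
            _ ≤ sup S V * sup T U := by gcongr
            _ = _ := mul_comm _ _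
        · rcases le_total (sup S V) (sup U V) with h | h
          · left; exact mul_le_mul h1 (h3.trans h) ‹_› ‹_›
          · right; calc
            _ ≤ sup S V * sup T U := by gcongr; exact h4.trans h
            _ = _ := mul_comm _ _
    · left; exact mul_le_mul h1 h2 ‹_› ‹_›
  · rcases h3 with h3 | h3
    · rcases h2 with h2 | h2
      · rcases h4 with h4 | h4
        · right; calc
            _ ≤ sup S V * sup T U := by gcongr
            _ = _ := mul_comm _ _
        · left; calc
            _ ≤ sup U V * sup S T := by gcongr
            _ = _ := mul_comm _ _
      · rcases h4 with h4 | h4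
        · rcases le_total (sup S V) (sup U V) with h | h
          · left; calc
            _ ≤ sup U V * sup S T := by gcongr; exact h4.trans h
            _ = _ := mul_comm _ _
          · right; exact mul_le_mul h1 (h2.trans h) ‹_› ‹_›
        · left; calc
            _ ≤ sup U V * sup S T := by gcongr
            _ = _ := mul_comm _ _
    · right; exact mul_le_mul h1 h3 ‹_› ‹_›

end Tree

/-- The projective tree `𝒜'_K = 𝒜_K ⊔ {∞}`. -/
inductive ProjTree (K : Type*) [NormedField K] [IsUltrametricDist K] : Type _
  | infty : ProjTree K
  | of (S : Tree K) : ProjTree K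

namespace ProjTree

/-- `sup {S, T} / (max {1, |S|} * max {1, |T|})`, extended by continuity to `∞`. -/
noncomputable def chordalSup : ProjTree K → ProjTree K → ℝ
  | infty, infty => 0
  | infty, of T => 1 / max 1 T.abs
  | of S, infty => 1 / max 1 S.abs
  | of S, of T => S.sup T / (max 1 S.abs * max 1 T.abs)

/-- The chordal distance
`Δ(S, T) = sup {S, T} / (max {1, |S|} * max {1, |T|}) - diam S / (2 * max {1, |S|} ^ 2)
  - diam T / (2 * max {1, |T|} ^ 2)`,
extended by continuity to `∞`. -/
noncomputable def chordalDist (S T : ProjTree K) : ℝ :=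
  chordalSup S T - chordalSup S S / 2 - chordalSup T T / 2

theorem chordalDist_of_of (S T : Tree K) :
    chordalDist (of S) (of T) = S.sup T / (max 1 S.abs * max 1 T.abs)
      - S.diam / (2 * max 1 S.abs ^ 2) - T.diam / (2 * max 1 T.abs ^ 2) := by
  simp only [chordalDist, chordalSup, Tree.sup_self]
  have h1 : max 1 S.abs ≠ 0 := (lt_max_of_lt_left one_pos).ne'
  have h2 : max 1 T.abs ≠ 0 := (lt_max_of_lt_left one_pos).ne'
  field_simp

theorem chordalDist_of_infty (S : Tree K) :
    chordalDist (of S) infty = 1 / max 1 S.abs - S.diam / (2 * max 1 S.abs ^ 2) := by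
  simp only [chordalDist, chordalSup, Tree.sup_self]
  have h1 : max 1 S.abs ≠ 0 := (lt_max_of_lt_left one_pos).ne'
  field_simp
  ring

theorem chordalSup_comm (S T : ProjTree K) : chordalSup S T = chordalSup T S := by
  cases S <;> cases T <;> simp only [chordalSup, Tree.sup_comm, mul_comm]

theorem chordalSup_triangle (S T U : ProjTree K) :
    chordalSup S U ≤ max (chordalSup S T) (chordalSup T U) := by
  have hpos : ∀ A : Tree K, 0 < max 1 A.abs := fun A => lt_max_of_lt_left one_pos
  have key : ∀ A B : Tree K, max 1 A.abs ≤ max (A.sup B) (max 1 B.abs) := fun A B => by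
    rw [Tree.max_one_abs, Tree.max_one_abs]
    exact Tree.sup_triangle _ _ _
  have nn : ∀ A B : Tree K, 0 ≤ A.sup B := fun A B =>
    (Tree.diam_nonneg A).trans (Tree.diam_le_sup A B)
  cases S with
  | infty =>
    cases U with
    | infty => cases T <;> simp [chordalSup, (hpos _).le]
    | of U =>
      cases T with
      | infty => simp [chordalSup]
      | of T =>
        simp only [chordalSup]
        have := hpos U
        have := hpos T
        rcases le_max_iff.1 (key T U) with h | h
        · apply le_max_of_le_right
          rw [div_le_div_iff₀ (by positivity) (by positivity)]
          nlinarith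
        · apply le_max_of_le_left
          gcongr
  | of S =>
    have := hpos S
    cases U with
    | infty =>
      cases T with
      | infty => simp [chordalSup]
      | of T =>
        simp only [chordalSup]
        have := hpos T
        rcases le_max_iff.1 (key T S) with h | h
        · apply le_max_of_le_left
          rw [div_le_div_iff₀ (by positivity) (by positivity)]
          rw [Tree.sup_comm] at h
          nlinarith
        · apply le_max_of_le_right
          gcongr
    | of U =>
      have := hpos U
      cases T with
      | infty =>
        simp only [chordalSup]
        have h : S.sup U ≤ max (max 1 S.abs) (max 1 U.abs) := by
          rw [Tree.max_one_abs, Tree.max_one_abs, Tree.sup_comm U]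
          exact Tree.sup_triangle _ _ _
        rcases le_max_iff.1 h with h | h
        · apply le_max_of_le_right
          rw [div_le_div_iff₀ (by positivity) (by positivity)]
          nlinarith
        · apply le_max_of_le_left
          rw [div_le_div_iff₀ (by positivity) (by positivity)]
          nlinarith
      | of T =>
        simp only [chordalSup]
        have := hpos T
        have h := Tree.sup_mul_sup_le S T U (Tree.mk 0 1 zero_le_one)
        simp only [← Tree.max_one_abs] at h
        rcases le_max_iff.1 h with h | h
        · apply le_max_of_le_left
          rw [div_le_div_iff₀ (by positivity) (by positivity)]
          nlinarith
        · apply le_max_of_le_right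
          rw [div_le_div_iff₀ (by positivity) (by positivity)]
          nlinarith

theorem chordalSup_self_le (S T : ProjTree K) : chordalSup S S ≤ chordalSup S T := by
  have := chordalSup_triangle S T S
  rwa [chordalSup_comm T S, max_self] at this

theorem eq_of_chordalDist_eq_zero (S T : ProjTree K) (h : chordalDist S T = 0) : S = T := by
  have h1 := chordalSup_self_le S T
  have h2 := chordalSup_self_le T S
  rw [chordalSup_comm T S] at h2
  have e1 : chordalSup S T = chordalSup S S := by unfold chordalDist at h; linarith
  have e2 : chordalSup S T = chordalSup T T := by unfold chordalDist at h; linarith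
  have hpos : ∀ A : Tree K, 0 < max 1 A.abs := fun A => lt_max_of_lt_left one_pos
  cases S with
  | infty =>
    cases T with
    | infty => rfl
    | of T =>
      simp only [chordalSup] at e1
      exact absurd e1 (one_div_pos.2 (hpos T)).ne'
  | of S =>
    cases T with
    | infty =>
      simp only [chordalSup] at e2
      exact absurd e2 (one_div_pos.2 (hpos S)).ne'
    | of T =>
      simp only [chordalSup, Tree.sup_self] at e1 e2
      have hS := hpos S
      have hT := hpos T
      rw [div_eq_div_iff (by positivity) (by positivity)] at e1 e2
      have a1 : S.sup T * max 1 S.abs = S.diam * max 1 T.abs := by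
        apply mul_right_cancel₀ hS.ne'; linarith
      have a2 : S.sup T * max 1 T.abs = T.diam * max 1 S.abs := by
        apply mul_right_cancel₀ hT.ne'; linarith
      have d1 := Tree.diam_le_sup S T
      have d2 := Tree.diam_le_sup T S
      rw [Tree.sup_comm T S] at d2
      have n1 := Tree.diam_nonneg S
      have n2 := Tree.diam_nonneg T
      have hd : dist S T = S.sup T - (S.diam + T.diam) / 2 := by rw [Tree.sup]; ring
      congr 1
      rw [← dist_eq_zero, hd]
      rcases le_total (max 1 S.abs) (max 1 T.abs) with hle | hle
      · have : S.sup T ≤ T.diam := by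
          refine le_of_mul_le_mul_right ?_ hT
          rw [a2]
          gcongr
        have : S.sup T ≤ S.diam := by
          have hTT : T.diam = S.sup T := le_antisymm d2 this
          rcases n2.eq_or_lt with h0 | h0
          · linarith
          · have : max 1 T.abs = max 1 S.abs := by
              apply mul_left_cancel₀ h0.ne'
              rw [← a2, hTT]
            rw [this] at a1
            exact (mul_right_cancel₀ hS.ne' a1).le
        linarith
      · have : S.sup T ≤ S.diam := by
          refine le_of_mul_le_mul_right ?_ hS
          rw [a1]
          gcongr
        have : S.sup T ≤ T.diam := by
          have hSS : S.diam = S.sup T := le_antisymm d1 this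
          rcases n1.eq_or_lt with h0 | h0
          · linarith
          · have : max 1 S.abs = max 1 T.abs := by
              apply mul_left_cancel₀ h0.ne'
              rw [← a1, hSS]
            rw [this] at a2
            exact (mul_right_cancel₀ hT.ne' a2).le
        linarith

noncomputable instance : MetricSpace (ProjTree K) where
  dist := chordalDist
  dist_self S := by simp only [chordalDist]; ring
  dist_comm S T := by simp only [chordalDist, chordalSup_comm S T]; ring
  dist_triangle S T U := by
    have h1 := chordalSup_self_le T S
    have h2 := chordalSup_self_le T U
    rw [chordalSup_comm T S] at h1
    simp only [chordalDist]
    rcases le_max_iff.1 (chordalSup_triangle S T U) with h | h <;> linarith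
  eq_of_dist_eq_zero := eq_of_chordalDist_eq_zero _ _

end ProjTree

end Tree

/-! ## The base field -/

section Field

variable (K : Type*) [NormedField K]

/-- The value group `|K*|`. -/
def valueGroup : Set ℝ := {r | ∃ x : K, x ≠ 0 ∧ ‖x‖ = r}

/-- The standing assumptions on the ultrametric field `K`: the residue field is infinite and the
value group is not discrete. -/
class AdmissibleField [IsUltrametricDist K] : Prop where
  infinite_residueField :
    Infinite (IsLocalRing.ResidueField (NormedField.valuation (K := K)).valuationSubring)
  not_discrete_valueGroup : ¬ DiscreteTopology (valueGroup K)

variable {K}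

theorem pos_of_mem_valueGroup {r : ℝ} (hr : r ∈ valueGroup K) : 0 < r := by
  obtain ⟨x, hx, rfl⟩ := hr
  exact norm_pos_iff.2 hx

theorem norm_sub_le_max' [IsUltrametricDist K] (x y : K) : ‖x - y‖ ≤ max ‖x‖ ‖y‖ := by
  simpa [sub_eq_add_neg] using IsUltrametricDist.norm_add_le_max x (-y)

variable [IsUltrametricDist K] [AdmissibleField K]

theorem exists_norm_mem_Ioo_one {q : ℝ} (hq : 1 < q) : ∃ x : K, 1 < ‖x‖ ∧ ‖x‖ < q := by
  by_contra! H
  refine AdmissibleField.not_discrete_valueGroup (K := K) ?_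
  rw [discreteTopology_iff_isOpen_singleton]
  rintro ⟨v, hv⟩
  have hvpos := pos_of_mem_valueGroup hv
  rw [Metric.isOpen_singleton_iff]
  refine ⟨v * (1 - 1 / q), mul_pos hvpos ?_, ?_⟩
  · rw [sub_pos, div_lt_one (by linarith)]
    exact hq
  rintro ⟨w, hw⟩ hd
  have hwpos := pos_of_mem_valueGroup hw
  obtain ⟨x, hx, rfl⟩ := hv
  obtain ⟨y, hy, rfl⟩ := hw
  rw [Subtype.dist_eq, Real.dist_eq, abs_lt] at hd
  have hq1 : 1 - 1 / q < q - 1 := by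
    have : 0 < q := by linarith
    rw [← sub_pos, show q - 1 - (1 - 1 / q) = (q - 1) ^ 2 / q by field_simp]
    have : 0 < q - 1 := by linarith
    positivity
  ext
  change ‖y‖ = ‖x‖
  rcases lt_trichotomy ‖y‖ ‖x‖ with h | h | h
  · exfalso
    have h1 : 1 < ‖x / y‖ := by rwa [norm_div, one_lt_div hwpos]
    have h2 := H _ h1
    rw [norm_div, le_div_iff₀ hwpos] at h2
    have h3 : ‖x‖ / q < ‖y‖ := by
      have := hd.1
      simp only at this
      have e : ‖x‖ * (1 - 1 / q) = ‖x‖ - ‖x‖ / q := by ring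
      linarith
    rw [div_lt_iff₀ (by linarith)] at h3
    linarith
  · exact h
  · exfalso
    have h1 : 1 < ‖y / x‖ := by rwa [norm_div, one_lt_div hvpos]
    have h2 := H _ h1
    rw [norm_div, le_div_iff₀ hvpos] at h2
    have := hd.2
    simp only at this
    nlinarith

/-- The value group is dense in the positive reals. -/
theorem exists_mem_valueGroup {s t : ℝ} (hs : 0 < s) (hst : s < t) :
    ∃ r ∈ valueGroup K, s < r ∧ r < t := by
  obtain ⟨x, hx1, hx2⟩ := exists_norm_mem_Ioo_one (K := K) ((one_lt_div hs).2 hst)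
  obtain ⟨n, hn1, hn2⟩ := exists_mem_Ico_zpow hs hx1
  have hx0 : x ≠ 0 := norm_pos_iff.1 (zero_lt_one.trans hx1)
  refine ⟨‖x‖ ^ (n + 1), ⟨x ^ (n + 1), zpow_ne_zero _ hx0, norm_zpow _ _⟩, hn2, ?_⟩
  rw [zpow_add_one₀ (norm_ne_zero_iff.2 hx0)]
  rw [lt_div_iff₀ hs] at hx2
  have : ‖x‖ ^ n * ‖x‖ ≤ s * ‖x‖ := by gcongr
  linarith

/-- A closed ball is not covered by finitely many open balls of at most the same radius. -/
theorem exists_mem_closedBall_forall_le {A : Set K} (hA : A.Finite) (b : K) {s : ℝ}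
    (hs : s ∈ valueGroup K) : ∃ x : K, ‖x - b‖ ≤ s ∧ ∀ a ∈ A, s ≤ ‖x - a‖ := by
  obtain ⟨c, hc, rfl⟩ := hs
  have hcpos : 0 < ‖c‖ := norm_pos_iff.2 hc
  let O := (NormedField.valuation (K := K)).valuationSubring
  have := AdmissibleField.infinite_residueField (K := K)
  have hfin : {ρ : IsLocalRing.ResidueField O |
      ∃ u : O, (u : K) ∈ (fun a => (a - b) / c) '' A ∧ IsLocalRing.residue O u = ρ}.Finite := by
    refine ((hA.image fun a => (a - b) / c).preimage
      (Subtype.val_injective (p := fun x => x ∈ O)).injOn).image (IsLocalRing.residue O) |>.subset ?_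
    rintro ρ ⟨u, hu, rfl⟩
    exact ⟨u, hu, rfl⟩
  obtain ⟨ρ, hρ⟩ := hfin.exists_notMem
  obtain ⟨y, rfl⟩ := IsLocalRing.residue_surjective ρ
  have hmem : ∀ u : K, u ∈ O ↔ ‖u‖ ≤ 1 := fun u => by
    rw [Valuation.mem_valuationSubring_iff, NormedField.valuation_apply]
    exact Iff.rfl
  have hy : ‖(y : K)‖ ≤ 1 := (hmem _).1 y.2
  refine ⟨b + c * y, by simpa using mul_le_of_le_one_right (norm_nonneg c) hy, fun a ha => ?_⟩
  have e : b + c * (y : K) - a = c * (y - (a - b) / c) := by field_simp; ring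
  rw [e, norm_mul]
  refine le_mul_of_one_le_right (norm_nonneg c) ?_
  by_contra! hlt
  have hu : ‖(a - b) / c‖ ≤ 1 := by
    have := norm_sub_le_max' (y : K) (y - (a - b) / c)
    rw [sub_sub_cancel] at this
    exact this.trans (max_le hy hlt.le)
  let u : O := ⟨(a - b) / c, (hmem _).2 hu⟩
  refine hρ ⟨u, ⟨a, ha, rfl⟩, ?_⟩
  rw [eq_comm, ← sub_eq_zero, ← map_sub, IsLocalRing.residue_eq_zero_iff,
    Valuation.mem_maximalIdeal_iff]
  exact hlt

end Field

/-! ## The projective line and its open balls -/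

section Line

/-- The projective line `ℙ¹_K = K ⊔ {∞}`. -/
def ProjLine (K : Type*) : Type _ := OnePoint K

section

variable {K : Type*}

/-- The inclusion of `K` in the projective line. -/
def ProjLine.ofField (x : K) : ProjLine K := (x : OnePoint K)

/-- The point `∞` of the projective line. -/
def ProjLine.infty : ProjLine K := (OnePoint.infty : OnePoint K)

theorem ProjLine.ofField_injective : Function.Injective (ProjLine.ofField (K := K)) :=
  OnePoint.coe_injective

theorem ProjLine.infty_ne_ofField (x : K) : (ProjLine.infty : ProjLine K) ≠ ProjLine.ofField x :=
  OnePoint.infty_ne_coe x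

theorem ProjLine.cases (z : ProjLine K) : z = ProjLine.infty ∨ ∃ x, z = ProjLine.ofField x := by
  induction z using OnePoint.rec with
  | infty => exact Or.inl rfl
  | coe x => exact Or.inr ⟨x, rfl⟩

/-- The set `V(C) = ⋃ Y ∈ C, Y × Y`. -/
def coverEntourage (C : Set (Set (ProjLine K))) : Set (ProjLine K × ProjLine K) :=
  ⋃ Y ∈ C, Y ×ˢ Y

theorem mem_coverEntourage {C : Set (Set (ProjLine K))} {x y : ProjLine K} :
    (x, y) ∈ coverEntourage C ↔ ∃ Y ∈ C, x ∈ Y ∧ y ∈ Y := by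
  simp only [coverEntourage, mem_iUnion, mem_prod, exists_prop]

end

variable {K : Type*} [NormedField K]

variable (K) in
/-- An open ball of the projective line, with radius in the value group: either the ball
`{z ∈ K | ‖z - center‖ < radius}` (when `outer = false`), or the complement in `ℙ¹_K` of the ball
`{z ∈ K | ‖z - center‖ ≤ radius}` (when `outer = true`). -/
structure OpenBall where
  center : K
  radius : ℝ
  radius_mem : radius ∈ valueGroup K
  outer : Bool

namespace OpenBall

instance : Nonempty (OpenBall K) := ⟨⟨0, 1, ⟨1, one_ne_zero, norm_one⟩, false⟩⟩

/-- The subset of the projective line defined by an open ball. -/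
def toSet : OpenBall K → Set (ProjLine K)
  | ⟨a, r, _, false⟩ => ProjLine.ofField '' {z | ‖z - a‖ < r}
  | ⟨a, r, _, true⟩ => (ProjLine.ofField '' {z | ‖z - a‖ ≤ r})ᶜ

/-- The open ball of the projective tree which corresponds to an open ball of the projective line:
either `{S ∈ 𝒜_K | sup {S, center} < radius}`, or the complement in `𝒜'_K` of
`{S ∈ 𝒜_K | sup {S, center} ≤ radius}`. -/
def treeSet [IsUltrametricDist K] : OpenBall K → Set (ProjTree K)
  | ⟨a, r, _, false⟩ => ProjTree.of '' {S | S.sup (Tree.ofField a) < r}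
  | ⟨a, r, _, true⟩ => (ProjTree.of '' {S | S.sup (Tree.ofField a) ≤ r})ᶜ

end OpenBall

/-- An open affinoid: a finite intersection of open balls. -/
def IsOpenAffinoid (Y : Set (ProjLine K)) : Prop :=
  ∃ J : Set (OpenBall K), J.Finite ∧ Y = ⋂ D ∈ J, D.toSet

/-- A finite cover of the projective line by open affinoids. -/
structure IsAffinoidCover (C : Set (Set (ProjLine K))) : Prop where
  finite : C.Finite
  isOpenAffinoid : ∀ Y ∈ C, IsOpenAffinoid Y
  sUnion_eq : ⋃₀ C = univ

namespace OpenBall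

variable {a x : K} {r : ℝ} {hr : r ∈ valueGroup K}

@[simp] theorem ofField_mem_inner :
    ProjLine.ofField x ∈ (⟨a, r, hr, false⟩ : OpenBall K).toSet ↔ ‖x - a‖ < r := by
  simp [toSet, ProjLine.ofField_injective.eq_iff]

@[simp] theorem ofField_mem_outer :
    ProjLine.ofField x ∈ (⟨a, r, hr, true⟩ : OpenBall K).toSet ↔ r < ‖x - a‖ := by
  simp [toSet, ProjLine.ofField_injective.eq_iff]

@[simp] theorem infty_notMem_inner :
    ProjLine.infty ∉ (⟨a, r, hr, false⟩ : OpenBall K).toSet := by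
  simp [toSet, (ProjLine.infty_ne_ofField _).symm]

@[simp] theorem infty_mem_outer :
    ProjLine.infty ∈ (⟨a, r, hr, true⟩ : OpenBall K).toSet := by
  simp [toSet, (ProjLine.infty_ne_ofField _).symm]

/-- A combinatorial condition for two open balls to cover the projective line. -/
def Covers (t : ℝ) : OpenBall K → OpenBall K → Prop
  | ⟨b, s, _, true⟩, ⟨a, r, _, false⟩ => s * t < r / t ∧ ‖a - b‖ < r / t
  | ⟨b, s, _, true⟩, ⟨b', s', _, true⟩ => s * t < ‖b - b'‖ ∧ s' * t < ‖b - b'‖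
  | _, _ => False

/-- The condition for two open balls to cover the projective line is an open one. -/
theorem Covers.eventually {D D' : OpenBall K} (h : Covers 1 D D') :
    ∀ᶠ t in 𝓝[>] (1 : ℝ), Covers t D D' := by
  obtain ⟨b, s, hs, o⟩ := D
  obtain ⟨a, r, hr, o'⟩ := D'
  have c1 : ∀ u : ℝ, Tendsto (fun t : ℝ => u * t) (𝓝[>] 1) (𝓝 (u * 1)) := fun u =>
    (tendsto_id.const_mul u).mono_left nhdsWithin_le_nhds
  have c2 : Tendsto (fun t : ℝ => r / t) (𝓝[>] 1) (𝓝 (r / 1)) :=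
    (tendsto_const_nhds.div tendsto_id one_ne_zero).mono_left nhdsWithin_le_nhds
  cases o <;> cases o' <;> simp only [Covers] at h ⊢
  · exact ((c1 s).eventually_lt c2 h.1).and (tendsto_const_nhds.eventually_lt c2 h.2)
  · exact ((c1 s).eventually_lt tendsto_const_nhds h.1).and
      ((c1 r).eventually_lt tendsto_const_nhds h.2)

variable [IsUltrametricDist K]

@[simp] theorem of_mem_inner {S : Tree K} :
    ProjTree.of S ∈ (⟨a, r, hr, false⟩ : OpenBall K).treeSet ↔ S.sup (Tree.ofField a) < r := by
  simp [treeSet]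

@[simp] theorem of_mem_outer {S : Tree K} :
    ProjTree.of S ∈ (⟨a, r, hr, true⟩ : OpenBall K).treeSet ↔ r < S.sup (Tree.ofField a) := by
  simp [treeSet]

@[simp] theorem tree_infty_notMem_inner :
    ProjTree.infty ∉ (⟨a, r, hr, false⟩ : OpenBall K).treeSet := by
  simp [treeSet]

@[simp] theorem tree_infty_mem_outer :
    ProjTree.infty ∈ (⟨a, r, hr, true⟩ : OpenBall K).treeSet := by
  simp [treeSet]

theorem Covers.treeSet {D D' : OpenBall K} (h : Covers 1 D D') (S : ProjTree K) :
    S ∈ D.treeSet ∨ S ∈ D'.treeSet := by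
  obtain ⟨b, s, hs, o⟩ := D
  obtain ⟨a, r, hr, o'⟩ := D'
  have hnorm : ∀ x y : K, (Tree.ofField x).sup (Tree.ofField y) = ‖x - y‖ := fun x y => by
    rw [Tree.ofField, Tree.ofField, Tree.mk, Tree.mk, Tree.sup_coe]
    simp [BallPair.sup]
  cases o <;> cases o' <;> simp only [Covers, mul_one, div_one] at h
  · cases S with
    | infty => simp
    | of S =>
      by_contra! hS
      simp only [of_mem_inner, of_mem_outer, not_lt] at hS
      have := Tree.sup_triangle S (Tree.ofField b) (Tree.ofField a)
      rw [hnorm, norm_sub_rev] at this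
      rcases le_max_iff.1 this with h' | h' <;> linarith [h.1, h.2]
  · cases S with
    | infty => simp
    | of S =>
      by_contra! hS
      simp only [of_mem_outer, not_lt] at hS
      have := Tree.sup_triangle (Tree.ofField b) S (Tree.ofField a)
      rw [hnorm, Tree.sup_comm] at this
      rcases le_max_iff.1 this with h' | h' <;> linarith [h.1, h.2]

/-- Among finitely many open balls covering the projective line, two already cover it. -/
theorem exists_covers [AdmissibleField K] {J : Set (OpenBall K)} (hJ : J.Finite)
    (hcov : ∀ z : ProjLine K, ∃ D ∈ J, z ∈ D.toSet) : ∃ D ∈ J, ∃ D' ∈ J, Covers 1 D D' := by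
  by_contra! H
  have hne : {D ∈ J | D.outer = true}.Nonempty := by
    obtain ⟨⟨a, r, hr, o⟩, hD, hz⟩ := hcov ProjLine.infty
    cases o
    · simp at hz
    · exact ⟨_, hD, rfl⟩
  obtain ⟨⟨b, s, hs, o⟩, ⟨hD, ho⟩, hmin⟩ :=
    exists_min_image _ OpenBall.radius (hJ.subset (sep_subset _ _)) hne
  simp only at ho
  subst ho
  obtain ⟨x, hx, hxa⟩ := exists_mem_closedBall_forall_le (hJ.image OpenBall.center) b hs
  obtain ⟨⟨a, r, hr, o⟩, hD', hz⟩ := hcov (ProjLine.ofField x)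
  have hH := H _ hD _ hD'
  cases o
  · simp only [ofField_mem_inner, Covers, mul_one, div_one, not_and, not_lt] at hz hH
    have hsr : s < r := (hxa a ⟨_, hD', rfl⟩).trans_lt hz
    refine absurd (hH hsr) (not_le.2 ?_)
    have := norm_sub_le_max' (x - b) (x - a)
    rw [sub_sub_sub_cancel_left] at this
    exact this.trans_lt (max_lt (hx.trans_lt hsr) hz)
  · simp only [ofField_mem_outer, Covers, mul_one, not_and, not_lt] at hz hH
    have hsr : s ≤ r := hmin _ ⟨hD', rfl⟩
    have hba : ‖b - a‖ ≤ r := by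
      by_contra! h
      linarith [hH (hsr.trans_lt h)]
    have := IsUltrametricDist.norm_add_le_max (x - b) (b - a)
    rw [sub_add_sub_cancel] at this
    linarith [this.trans (max_le (hx.trans hsr) hba)]

/-- A ball slightly larger than the complement of an open ball. -/
theorem exists_flip [AdmissibleField K] {t : ℝ} (ht : 1 < t) : ∃ E : OpenBall K → OpenBall K,
    (∀ D z, z ∈ D.toSet ∨ z ∈ (E D).toSet) ∧
    ∀ D D', Covers t D D' → ∀ z, z ∈ (E D).toSet → z ∉ (E D').toSet := by
  have ht0 : 0 < t := by linarith
  have h1 : ∀ D : OpenBall K, ∃ ρ ∈ valueGroup K, D.radius / t < ρ ∧ ρ < D.radius := fun D =>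
    have := pos_of_mem_valueGroup D.radius_mem
    exists_mem_valueGroup (by positivity) (div_lt_self this ht)
  have h2 : ∀ D : OpenBall K, ∃ ρ ∈ valueGroup K, D.radius < ρ ∧ ρ < D.radius * t := fun D =>
    have := pos_of_mem_valueGroup D.radius_mem
    exists_mem_valueGroup this (lt_mul_of_one_lt_right this ht)
  choose f hf hf1 hf2 using h1
  choose g hg hg1 hg2 using h2
  refine ⟨fun D => match D.outer with
    | false => ⟨D.center, f D, hf D, true⟩
    | true => ⟨D.center, g D, hg D, false⟩, ?_, ?_⟩
  · rintro ⟨a, r, hr, o⟩ z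
    rcases z.cases with rfl | ⟨x, rfl⟩
    · cases o <;> simp
    · cases o
      · simp only [ofField_mem_inner, ofField_mem_outer]
        have := hf2 ⟨a, r, hr, false⟩
        simp only at this
        by_contra! h
        linarith [h.1, h.2]
      · simp only [ofField_mem_inner, ofField_mem_outer]
        have := hg1 ⟨a, r, hr, true⟩
        simp only at this
        by_contra! h
        linarith [h.1, h.2]
  · rintro ⟨b, s, hs, o⟩ ⟨a, r, hr, o'⟩ h z
    rcases z.cases with rfl | ⟨x, rfl⟩
    · cases o <;> cases o' <;> simp [Covers] at h ⊢
    · cases o <;> cases o' <;> simp only [Covers] at h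
      · have e1 := hg2 ⟨b, s, hs, true⟩
        have e2 := hf1 ⟨a, r, hr, false⟩
        simp only [ofField_mem_inner, ofField_mem_outer, not_lt] at e1 e2 ⊢
        intro hz
        have := IsUltrametricDist.norm_add_le_max (x - b) (b - a)
        rw [sub_add_sub_cancel, norm_sub_rev b a] at this
        exact this.trans (max_le (by linarith [h.1]) (by linarith [h.2]))
      · have e1 := hg2 ⟨b, s, hs, true⟩
        have e2 := hg2 ⟨a, r, hr, true⟩
        simp only [ofField_mem_inner, not_lt] at e1 e2 ⊢
        intro hz
        by_contra! hz'
        have := norm_sub_le_max' (x - a) (x - b)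
        rw [sub_sub_sub_cancel_left] at this
        exact absurd this (not_le.2 (max_lt (by linarith [h.2]) (by linarith [h.1])))

end OpenBall

theorem isAffinoidCover_univ : IsAffinoidCover ({univ} : Set (Set (ProjLine K))) where
  finite := finite_singleton _
  isOpenAffinoid := by
    rintro Y rfl
    exact ⟨∅, finite_empty, by simp⟩
  sUnion_eq := by simp

theorem IsAffinoidCover.inter {C C' : Set (Set (ProjLine K))} (hC : IsAffinoidCover C)
    (hC' : IsAffinoidCover C') : IsAffinoidCover (image2 (· ∩ ·) C C') where
  finite := hC.finite.image2 _ hC'.finite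
  isOpenAffinoid := by
    rintro _ ⟨Y, hY, Y', hY', rfl⟩
    obtain ⟨J, hJ, rfl⟩ := hC.isOpenAffinoid Y hY
    obtain ⟨J', hJ', rfl⟩ := hC'.isOpenAffinoid Y' hY'
    exact ⟨J ∪ J', hJ.union hJ', by rw [biInter_union]⟩
  sUnion_eq := by
    refine eq_univ_of_forall fun z => ?_
    obtain ⟨Y, hY, hz⟩ := hC.sUnion_eq.symm ▸ mem_univ z
    obtain ⟨Y', hY', hz'⟩ := hC'.sUnion_eq.symm ▸ mem_univ z
    exact ⟨_, mem_image2_of_mem hY hY', hz, hz'⟩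

variable (K) in
/-- The filter of entourages: the sets which contain `V(C)` for some finite cover `C` of `ℙ¹_K` by
open affinoids. -/
def affinoidUniformity : Filter (ProjLine K × ProjLine K) where
  sets := {V | ∃ C, IsAffinoidCover C ∧ coverEntourage C ⊆ V}
  univ_sets := ⟨_, isAffinoidCover_univ, subset_univ _⟩
  sets_of_superset := fun ⟨C, hC, h⟩ h' => ⟨C, hC, h.trans h'⟩
  inter_sets := by
    rintro V V' ⟨C, hC, h⟩ ⟨C', hC', h'⟩
    refine ⟨_, hC.inter hC', ?_⟩
    rintro ⟨x, y⟩ hxy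
    obtain ⟨_, ⟨Y, hY, Y', hY', rfl⟩, hx, hy⟩ := mem_coverEntourage.1 hxy
    exact ⟨h (mem_coverEntourage.2 ⟨Y, hY, hx.1, hy.1⟩),
      h' (mem_coverEntourage.2 ⟨Y', hY', hx.2, hy.2⟩)⟩

theorem mem_affinoidUniformity {V : Set (ProjLine K × ProjLine K)} :
    V ∈ affinoidUniformity K ↔ ∃ C, IsAffinoidCover C ∧ coverEntourage C ⊆ V := Iff.rfl

variable [IsUltrametricDist K] [AdmissibleField K]

/-- If a ball is chosen for each element of a cover by affinoids, two of these balls cover `ℙ¹_K`. -/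
theorem IsAffinoidCover.exists_covers {C : Set (Set (ProjLine K))} (hC : IsAffinoidCover C)
    {P : OpenBall K → Prop}
    (h : ∀ Y ∈ C, ∃ D : OpenBall K, Y ⊆ D.toSet ∧ P D) :
    ∃ D D', P D ∧ P D' ∧ OpenBall.Covers 1 D D' := by
  choose! D hYD hP using h
  obtain ⟨_, ⟨Y, hY, rfl⟩, _, ⟨Y', hY', rfl⟩, hc⟩ :=
    OpenBall.exists_covers (hC.finite.image D) fun z => by
      obtain ⟨Y, hY, hz⟩ := hC.sUnion_eq.symm ▸ mem_univ z
      exact ⟨D Y, mem_image_of_mem D hY, hYD Y hY hz⟩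
  exact ⟨_, _, hP Y hY, hP Y' hY', hc⟩

theorem exists_comp_subset {C : Set (Set (ProjLine K))} (hC : IsAffinoidCover C) :
    ∃ W ∈ affinoidUniformity K, ∀ x y z, (x, y) ∈ W → (y, z) ∈ W → (x, z) ∈ coverEntourage C := by
  have hJ := hC.isOpenAffinoid
  choose! J hJfin hJ using hJ
  have hfin : (⋃ Y ∈ C, J Y).Finite := hC.finite.biUnion hJfin
  have hev : ∀ᶠ t in 𝓝[>] (1 : ℝ), ∀ D ∈ ⋃ Y ∈ C, J Y, ∀ D' ∈ ⋃ Y ∈ C, J Y,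
      OpenBall.Covers 1 D D' → OpenBall.Covers t D D' := by
    rw [eventually_all_finite hfin]
    intro D _
    rw [eventually_all_finite hfin]
    intro D' _
    by_cases h : OpenBall.Covers 1 D D'
    · simpa [h] using h.eventually
    · simp [h]
  obtain ⟨t, ht, ht1⟩ := (hev.and self_mem_nhdsWithin).exists
  obtain ⟨E, hE1, hE2⟩ := OpenBall.exists_flip (K := K) (t := t) ht1
  let C' : Set (ProjLine K) → Set (Set (ProjLine K)) := fun Y =>
    insert Y ((fun D => (E D).toSet) '' J Y)
  have hC' : ∀ Y ∈ C, IsAffinoidCover (C' Y) := fun Y hY =>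
    { finite := ((hJfin Y hY).image _).insert _
      isOpenAffinoid := by
        rintro Z (rfl | ⟨D, -, rfl⟩)
        · exact hC.isOpenAffinoid _ hY
        · exact ⟨{E D}, finite_singleton _, by simp⟩
      sUnion_eq := by
        refine eq_univ_of_forall fun z => ?_
        by_cases hz : z ∈ Y
        · exact ⟨Y, mem_insert _ _, hz⟩
        · rw [hJ Y hY] at hz
          simp only [mem_iInter, not_forall] at hz
          obtain ⟨D, hD, hz⟩ := hz
          exact ⟨_, mem_insert_of_mem _ ⟨D, hD, rfl⟩, (hE1 D z).resolve_left hz⟩ }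
  refine ⟨⋂ Y ∈ C, coverEntourage (C' Y), (biInter_mem hC.finite).2 fun Y hY =>
    ⟨C' Y, hC' Y hY, Subset.rfl⟩, fun x y z hxy hyz => ?_⟩
  have key : ∃ Y ∈ C, ∀ D ∈ J Y, y ∉ (E D).toSet := by
    by_contra! H
    obtain ⟨D, D', ⟨hD, hyD⟩, ⟨hD', hyD'⟩, hc⟩ := hC.exists_covers
      (P := fun D => D ∈ ⋃ Y ∈ C, J Y ∧ y ∈ (E D).toSet) fun Y hY => by
        obtain ⟨D, hD, hy⟩ := H Y hY
        refine ⟨D, ?_, mem_biUnion hY hD, hy⟩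
        rw [hJ Y hY]
        exact biInter_subset_of_mem hD
    exact hE2 D D' (ht D hD D' hD' hc) y hyD hyD'
  obtain ⟨Y, hY, hy⟩ := key
  have h1 := mem_iInter₂.1 hxy Y hY
  have h2 := mem_iInter₂.1 hyz Y hY
  obtain ⟨Z, hZ, hx, hyZ⟩ := mem_coverEntourage.1 h1
  obtain ⟨Z', hZ', hyZ', hz⟩ := mem_coverEntourage.1 h2
  have e1 : Z = Y := by
    rcases hZ with rfl | ⟨D, hD, rfl⟩
    · rfl
    · exact absurd hyZ (hy D hD)
  have e2 : Z' = Y := by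
    rcases hZ' with rfl | ⟨D, hD, rfl⟩
    · rfl
    · exact absurd hyZ' (hy D hD)
  subst e1 e2
  exact mem_coverEntourage.2 ⟨_, hY, hx, hz⟩

/-- The uniform structure on the projective line defined by the finite covers by open affinoids. -/
instance : UniformSpace (ProjLine K) := UniformSpace.ofCore
  { uniformity := affinoidUniformity K
    refl := by
      rintro V ⟨C, hC, hV⟩ ⟨x, y⟩ (rfl : x = y)
      obtain ⟨Y, hY, hx⟩ := hC.sUnion_eq.symm ▸ mem_univ x
      exact hV (mem_coverEntourage.2 ⟨Y, hY, hx, hx⟩)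
    symm := by
      rintro V ⟨C, hC, hV⟩
      refine ⟨C, hC, ?_⟩
      rintro ⟨x, y⟩ hxy
      obtain ⟨Y, hY, hx, hy⟩ := mem_coverEntourage.1 hxy
      exact hV (mem_coverEntourage.2 ⟨Y, hY, hy, hx⟩)
    comp := by
      rintro V ⟨C, hC, hV⟩
      obtain ⟨W, hW, h⟩ := exists_comp_subset hC
      refine mem_of_superset (mem_lift' hW) ?_
      rintro ⟨x, z⟩ ⟨y, hxy, hyz⟩
      exact hV (h x y z hxy hyz) }

theorem mem_uniformity_projLine {V : Set (ProjLine K × ProjLine K)} :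
    V ∈ uniformity (ProjLine K) ↔ ∃ C, IsAffinoidCover C ∧ coverEntourage C ⊆ V := Iff.rfl

variable (K) in
/-- The Berkovich projective line: the separated completion of the projective line for the uniform
structure of the finite covers by open affinoids. -/
abbrev BerkLine : Type _ := Completion (ProjLine K)

end Line

/-! ## The identification of the tree with the Berkovich projective line -/

section Identification

variable {K : Type*} [NormedField K] [IsUltrametricDist K]

/-- The filter on the projective line generated by the open balls whose corresponding ball of the
projective tree contains `S`. -/
def ballFilter (S : ProjTree K) : Filter (ProjLine K) :=
  Filter.generate {B | ∃ D : OpenBall K, S ∈ D.treeSet ∧ B = D.toSet}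

theorem biInter_mem_ballFilter {S : ProjTree K} {J : Set (OpenBall K)} (hJ : J.Finite)
    (h : ∀ D ∈ J, S ∈ D.treeSet) : ⋂ D ∈ J, D.toSet ∈ ballFilter S :=
  (biInter_mem hJ).2 fun D hD => Filter.GenerateSets.basic ⟨D, h D hD, rfl⟩

theorem ProjTree.continuous_chordalSup (T : ProjTree K) :
    Continuous fun S => ProjTree.chordalSup S T := by
  have h : ∀ S T : ProjTree K, ProjTree.chordalSup S T =
      dist S T + (ProjTree.chordalSup S S + ProjTree.chordalSup T T) / 2 := fun S T => by
    change _ = ProjTree.chordalDist S T + _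
    rw [ProjTree.chordalDist]
    ring
  have hself : Continuous fun S : ProjTree K => ProjTree.chordalSup S S := by
    refine (LipschitzWith.of_dist_le_mul (K := 2) fun S T => ?_).continuous
    have h1 := ProjTree.chordalSup_self_le S T
    have h2 := ProjTree.chordalSup_self_le T S
    rw [ProjTree.chordalSup_comm T S] at h2
    have := h S T
    rw [Real.dist_eq, abs_le]
    constructor <;> push_cast <;> linarith
  have e : (fun S => ProjTree.chordalSup S T) = fun S =>
      dist S T + (ProjTree.chordalSup S S + ProjTree.chordalSup T T) / 2 := funext fun S => h S T
  rw [e]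
  fun_prop

theorem isOpen_treeSet (D : OpenBall K) : IsOpen D.treeSet := by
  obtain ⟨a, r, hr, o⟩ := D
  have hr0 := pos_of_mem_valueGroup hr
  set A := ProjTree.of (Tree.ofField a)
  have c1 := ProjTree.continuous_chordalSup A
  have c2 := (ProjTree.continuous_chordalSup (ProjTree.infty : ProjTree K)).const_mul
    (r * ProjTree.chordalSup A ProjTree.infty)
  have hpos : ∀ T : Tree K, 0 < max 1 T.abs := fun T => lt_max_of_lt_left one_pos
  have hA := hpos (Tree.ofField a)
  have e : ∀ S : Tree K, r * ProjTree.chordalSup A ProjTree.infty *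
      ProjTree.chordalSup (ProjTree.of S) ProjTree.infty =
      r / (max 1 S.abs * max 1 (Tree.ofField a).abs) := fun S => by
    simp only [A, ProjTree.chordalSup]
    have := hpos S
    field_simp
  cases o
  · convert isOpen_lt c1 c2 using 1
    ext S
    cases S with
    | infty =>
      simp only [OpenBall.tree_infty_notMem_inner, false_iff, mem_ofPred_eq, not_lt]
      simp only [A, ProjTree.chordalSup, mul_zero]
      positivity
    | of S =>
      rw [OpenBall.of_mem_inner, mem_ofPred_eq, e]
      simp only [A, ProjTree.chordalSup]
      have := hpos S
      rw [div_lt_div_iff_of_pos_right (by positivity)]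
  · convert isOpen_lt c2 c1 using 1
    ext S
    cases S with
    | infty =>
      simp only [OpenBall.tree_infty_mem_outer, true_iff, mem_ofPred_eq]
      simp only [A, ProjTree.chordalSup, mul_zero]
      positivity
    | of S =>
      rw [OpenBall.of_mem_outer, mem_ofPred_eq, e]
      simp only [A, ProjTree.chordalSup]
      have := hpos S
      rw [div_lt_div_iff_of_pos_right (by positivity)]

theorem exists_finite_of_mem_ballFilter {S : ProjTree K} {U : Set (ProjLine K)}
    (hU : U ∈ ballFilter S) : ∃ J : Set (OpenBall K), J.Finite ∧ (∀ D ∈ J, S ∈ D.treeSet) ∧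
      ⋂ D ∈ J, D.toSet ⊆ U := by
  obtain ⟨t, ht, htfin, htU⟩ := Filter.mem_generate_iff.1 hU
  choose! D hD1 hD2 using ht
  refine ⟨D '' t, htfin.image D, ?_, ?_⟩
  · rintro _ ⟨B, hB, rfl⟩
    exact hD1 hB
  · intro z hz
    refine htU fun B hB => ?_
    rw [hD2 hB]
    exact mem_iInter₂.1 hz _ (mem_image_of_mem D hB)

variable [AdmissibleField K]

theorem OpenBall.exists_flip_of_mem {S : ProjTree K} {D : OpenBall K} (hS : S ∈ D.treeSet) :
    ∃ D' E : OpenBall K, S ∈ D'.treeSet ∧ S ∉ E.treeSet ∧ (∀ z, z ∈ D.toSet ∨ z ∈ E.toSet) ∧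
      ∀ z, z ∈ D'.toSet → z ∉ E.toSet := by
  obtain ⟨a, r, hr, o⟩ := D
  cases o
  · cases S with
    | infty => simp at hS
    | of S =>
      rw [of_mem_inner] at hS
      have h0 : 0 ≤ S.sup (Tree.ofField a) := (Tree.diam_nonneg S).trans (Tree.diam_le_sup _ _)
      obtain ⟨ρ, hρ, h1, h2⟩ := exists_mem_valueGroup (K := K)
        (lt_max_of_lt_right (half_pos (pos_of_mem_valueGroup hr)))
        (max_lt hS (half_lt_self (pos_of_mem_valueGroup hr)))
      have h1 := (le_max_left _ _).trans_lt h1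
      refine ⟨⟨a, ρ, hρ, false⟩, ⟨a, ρ, hρ, true⟩, by simpa, by simpa using h1.le, ?_, ?_⟩
      · intro z
        rcases z.cases with rfl | ⟨x, rfl⟩
        · simp
        · simp only [ofField_mem_inner, ofField_mem_outer]
          by_contra! h
          linarith [h.1, h.2]
      · intro z
        rcases z.cases with rfl | ⟨x, rfl⟩
        · simp
        · simp only [ofField_mem_inner, ofField_mem_outer]
          exact fun h => h.le.not_gt
  · have : ∃ ρ ∈ valueGroup K, r < ρ ∧ ∀ hρ, S ∈ (⟨a, ρ, hρ, true⟩ : OpenBall K).treeSet ∧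
        S ∉ (⟨a, ρ, hρ, false⟩ : OpenBall K).treeSet := by
      cases S with
      | infty =>
        obtain ⟨ρ, hρ, h1, -⟩ := exists_mem_valueGroup (K := K) (pos_of_mem_valueGroup hr)
          (lt_add_one r)
        exact ⟨ρ, hρ, h1, by simp⟩
      | of S =>
        rw [of_mem_outer] at hS
        obtain ⟨ρ, hρ, h1, h2⟩ := exists_mem_valueGroup (K := K) (pos_of_mem_valueGroup hr) hS
        exact ⟨ρ, hρ, h1, by simp [h2, h2.le]⟩
    obtain ⟨ρ, hρ, h1, h2⟩ := this
    refine ⟨⟨a, ρ, hρ, true⟩, ⟨a, ρ, hρ, false⟩, (h2 hρ).1, (h2 hρ).2, ?_, ?_⟩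
    · intro z
      rcases z.cases with rfl | ⟨x, rfl⟩
      · simp
      · simp only [ofField_mem_inner, ofField_mem_outer]
        by_contra! h
        linarith [h.1, h.2]
    · intro z
      rcases z.cases with rfl | ⟨x, rfl⟩
      · simp
      · simp only [ofField_mem_inner, ofField_mem_outer]
        exact fun h => h.le.not_gt

theorem exists_mem_of_mem_treeSet {S : ProjTree K} {J J' : Set (OpenBall K)} (hJ : J.Finite)
    (hJ' : J'.Finite) (h : ∀ D ∈ J, S ∈ D.treeSet) (h' : ∀ D ∈ J', S ∉ D.treeSet) :
    ∃ z, (∀ D ∈ J, z ∈ D.toSet) ∧ ∀ D ∈ J', z ∉ D.toSet := by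
  choose! D₁ E h1 h2 h3 h4 using fun (D : OpenBall K) (hD : D ∈ J) =>
    OpenBall.exists_flip_of_mem (h D hD)
  by_contra! H
  have hnot : ∀ D ∈ E '' J ∪ J', S ∉ D.treeSet := by
    rintro _ (⟨D, hD, rfl⟩ | hD)
    · exact h2 D hD
    · exact h' _ hD
  obtain ⟨D, hD, D', hD', hc⟩ := OpenBall.exists_covers ((hJ.image E).union hJ') fun z => by
    by_cases hz : ∀ D ∈ J, z ∈ D.toSet
    · obtain ⟨D, hD, hzD⟩ := H z hz
      exact ⟨D, Or.inr hD, hzD⟩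
    · push Not at hz
      obtain ⟨D, hD, hz⟩ := hz
      exact ⟨E D, Or.inl ⟨D, hD, rfl⟩, (h3 D hD z).resolve_left hz⟩
  exact (hc.treeSet S).elim (hnot D hD) (hnot D' hD')

instance ballFilter_neBot (S : ProjTree K) : (ballFilter S).NeBot := by
  refine ⟨fun h => ?_⟩
  obtain ⟨J, hJ, hS, hJU⟩ := exists_finite_of_mem_ballFilter (h ▸ Filter.mem_bot : ∅ ∈ ballFilter S)
  obtain ⟨z, hz, -⟩ := exists_mem_of_mem_treeSet hJ finite_empty hS (by simp)
  exact hJU (mem_iInter₂.2 hz)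

theorem IsAffinoidCover.exists_treeSet {C : Set (Set (ProjLine K))} (hC : IsAffinoidCover C)
    (S : ProjTree K) : ∃ J : Set (OpenBall K), J.Finite ∧ ⋂ D ∈ J, D.toSet ∈ C ∧
      ∀ D ∈ J, S ∈ D.treeSet := by
  by_contra! H
  obtain ⟨D, D', hD, hD', hc⟩ := hC.exists_covers (P := fun D => S ∉ D.treeSet) fun Y hY => by
    obtain ⟨J, hJ, rfl⟩ := hC.isOpenAffinoid Y hY
    obtain ⟨D, hD, hS⟩ := H J hJ hY
    exact ⟨D, biInter_subset_of_mem hD, hS⟩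
  exact (hc.treeSet S).elim hD hD'

theorem cauchy_ballFilter (S : ProjTree K) : Cauchy (ballFilter S) := by
  refine ⟨inferInstance, ?_⟩
  rintro V ⟨C, hC, hV⟩
  obtain ⟨J, hJ, hY, hS⟩ := hC.exists_treeSet S
  have hmem := biInter_mem_ballFilter hJ hS
  refine mem_of_superset (prod_mem_prod hmem hmem) ?_
  rintro ⟨x, y⟩ ⟨hx, hy⟩
  exact hV (mem_coverEntourage.2 ⟨_, hY, hx, hy⟩)

/-- The identification `ι` of the projective tree with the Berkovich projective line: the point `S`
is sent to the limit of the Cauchy filter generated by the open balls of `ℙ¹_K` whose corresponding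
ball of the tree contains `S`. It is the continuous map that sends `[a, r]`, with `r > 0`, to the
point determined by the ball `{z ∈ K | ‖z - a‖ ≤ r}`, see `continuous_iota` and
`residualBall_iota` below. -/
noncomputable def iota (S : ProjTree K) : BerkLine K :=
  SeparationQuotient.mk (⟨ballFilter S, cauchy_ballFilter S⟩ : CauchyFilter (ProjLine K))

/-- The minimal Cauchy filter on the projective line given by a point of the completion. -/
def minimalFilter (p : BerkLine K) : Filter (ProjLine K) := Filter.comap (↑) (𝓝 p)

/-- The intersection `B_F` of all balls of `K` that belong to the minimal Cauchy filter `F`. -/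
def residualBall (p : BerkLine K) : Set K :=
  {z | ∀ (b : K) (ρ : ℝ), 0 < ρ → ∀ B, (B = {x | ‖x - b‖ < ρ} ∨ B = {x | ‖x - b‖ ≤ ρ}) →
    ProjLine.ofField '' B ∈ minimalFilter p → z ∈ B}

theorem mem_minimalFilter_iota {S : ProjTree K} {U : Set (ProjLine K)} :
    U ∈ minimalFilter (iota S) ↔ ∃ C, IsAffinoidCover C ∧
      ∀ y, {x | (x, y) ∈ coverEntourage C} ∈ ballFilter S → y ∈ U := by
  set f : CauchyFilter (ProjLine K) := ⟨ballFilter S, cauchy_ballFilter S⟩ with hf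
  have e : minimalFilter (iota S) = Filter.comap CauchyFilter.pureCauchy (𝓝 f) := by
    exact Filter.comap_comap.symm.trans
      (congrArg (Filter.comap CauchyFilter.pureCauchy) SeparationQuotient.comap_mk_nhds_mk)
  have hprod : ∀ (V : Set (ProjLine K × ProjLine K)) (y : ProjLine K),
      V ∈ f.1 ×ˢ (CauchyFilter.pureCauchy y).1 ↔ {x | (x, y) ∈ V} ∈ ballFilter S := fun V y => by
    change V ∈ ballFilter S ×ˢ pure y ↔ _
    rw [prod_pure, mem_map]
    rfl
  rw [e, UniformSpace.nhds_eq_comap_uniformity, Filter.comap_comap, mem_comap]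
  constructor
  · rintro ⟨s, hs, hsU⟩
    obtain ⟨V, ⟨C, hC, hCV⟩, hV⟩ := CauchyFilter.mem_uniformity'.1 hs
    refine ⟨C, hC, fun y hy => hsU (hV f _ ?_)⟩
    exact mem_of_superset ((hprod _ y).2 hy) hCV
  · rintro ⟨C, hC, h⟩
    refine ⟨CauchyFilter.gen (coverEntourage C), CauchyFilter.mem_uniformity'.2
      ⟨coverEntourage C, ⟨C, hC, Subset.rfl⟩, fun _ _ h => h⟩, fun y hy => ?_⟩
    exact h y ((hprod _ y).1 hy)

theorem ballFilter_le_minimalFilter (S : ProjTree K) :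
    ballFilter S ≤ minimalFilter (iota S) := by
  intro U hU
  obtain ⟨C, hC, h⟩ := mem_minimalFilter_iota.1 hU
  obtain ⟨J, hJ, hY, hS⟩ := hC.exists_treeSet S
  have hmem := biInter_mem_ballFilter hJ hS
  refine mem_of_superset hmem fun y hy => h y (mem_of_superset hmem fun x hx => ?_)
  exact mem_coverEntourage.2 ⟨_, hY, hx, hy⟩

/-- The identification preserves the correspondence between open balls. -/
theorem toSet_mem_minimalFilter_iota {S : ProjTree K} {D : OpenBall K} :
    D.toSet ∈ minimalFilter (iota S) ↔ S ∈ D.treeSet := by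
  constructor
  · intro hD
    by_contra hS
    obtain ⟨J, hJ, hJS, hJD⟩ := exists_finite_of_mem_ballFilter (ballFilter_le_minimalFilter S hD)
    obtain ⟨z, hz, hz'⟩ := exists_mem_of_mem_treeSet hJ (finite_singleton D) hJS (by simpa)
    exact hz' D rfl (hJD (mem_iInter₂.2 hz))
  · intro hS
    obtain ⟨D', E, hD', -, hcov, hdisj⟩ := OpenBall.exists_flip_of_mem hS
    have hD'mem : D'.toSet ∈ ballFilter S := Filter.GenerateSets.basic ⟨D', hD', rfl⟩
    refine mem_minimalFilter_iota.2 ⟨{D.toSet, E.toSet}, ⟨by simp, ?_, ?_⟩, fun y hy => ?_⟩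
    · rintro Y (rfl | rfl)
      · exact ⟨{D}, finite_singleton _, by simp⟩
      · exact ⟨{E}, finite_singleton _, by simp⟩
    · refine eq_univ_of_forall fun z => ?_
      simpa using hcov z
    · obtain ⟨x, hx, hx'⟩ := (ballFilter_neBot S).nonempty_of_mem (inter_mem hy hD'mem)
      obtain ⟨Z, hZ, hxZ, hyZ⟩ := mem_coverEntourage.1 hx
      rcases hZ with rfl | rfl
      · exact hyZ
      · exact absurd hxZ (hdisj x hx')

theorem continuous_iota : Continuous (iota (K := K)) := by
  refine SeparationQuotient.continuous_mk.comp (continuous_iff_continuousAt.2 fun S => ?_)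
  refine Uniform.tendsto_nhds_right.2 fun s hs => ?_
  obtain ⟨V, ⟨C, hC, hCV⟩, hV⟩ := CauchyFilter.mem_uniformity'.1 hs
  obtain ⟨J, hJ, hY, hS⟩ := hC.exists_treeSet S
  have hopen : ∀ᶠ T in 𝓝 S, ∀ D ∈ J, T ∈ D.treeSet :=
    (eventually_all_finite hJ).2 fun D hD => (isOpen_treeSet D).mem_nhds (hS D hD)
  rw [mem_map]
  refine mem_of_superset hopen fun T hT => ?_
  refine hV _ _ (mem_of_superset
    (prod_mem_prod (biInter_mem_ballFilter hJ hS) (biInter_mem_ballFilter hJ hT)) ?_)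
  rintro ⟨x, y⟩ ⟨hx, hy⟩
  exact hCV (mem_coverEntourage.2 ⟨_, hY, hx, hy⟩)

theorem residualBall_iota (a : K) (r : ℝ) (hr : 0 < r) :
    residualBall (iota (ProjTree.of (Tree.mk a r hr.le))) = {z | ‖z - a‖ ≤ r} := by
  have hsup : ∀ b : K, (Tree.mk a r hr.le).sup (Tree.ofField b) = max r ‖a - b‖ := fun b => by
    rw [Tree.ofField, Tree.mk, Tree.mk, Tree.sup_coe]
    simp [BallPair.sup, hr.le]
  have hinner : ∀ (b : K) (ρ : ℝ) (_ : ρ ∈ valueGroup K),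
      ProjLine.ofField '' {x | ‖x - b‖ < ρ} ∈ minimalFilter (iota (.of (Tree.mk a r hr.le))) ↔
        max r ‖a - b‖ < ρ := fun b ρ hρ => by
    rw [← hsup, ← OpenBall.of_mem_inner (hr := hρ), ← toSet_mem_minimalFilter_iota]
    rfl
  ext z
  constructor
  · intro hz
    change ‖z - a‖ ≤ r
    refine le_of_forall_gt fun t ht => ?_
    obtain ⟨ρ, hρ, h1, h2⟩ := exists_mem_valueGroup (K := K) hr ht
    refine lt_trans (b := ρ) ?_ h2
    exact hz a ρ (hr.trans h1) _ (Or.inl rfl) ((hinner a ρ hρ).2 (by simpa [hr] using And.intro h1 (hr.trans h1)))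
  · intro hz b ρ hρ B hB hmem
    have hzb : ‖z - b‖ ≤ max r ‖a - b‖ := by
      have := IsUltrametricDist.norm_add_le_max (z - a) (a - b)
      rw [sub_add_sub_cancel] at this
      exact this.trans (max_le_max_right _ hz)
    have hle : max r ‖a - b‖ ≤ ρ := by
      refine le_of_forall_gt fun t ht => ?_
      obtain ⟨ρ', hρ', h1, h2⟩ := exists_mem_valueGroup (K := K) hρ ht
      refine ((hinner b ρ' hρ').1 (mem_of_superset hmem (image_mono ?_))).trans h2
      rcases hB with rfl | rfl <;> intro x hx <;> simp only [mem_ofPred_eq] at hx ⊢ <;> linarith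
    rcases hB with rfl | rfl
    · refine lt_of_le_of_ne (hzb.trans hle) fun heq => ?_
      have hρ' : ρ ∈ valueGroup K := ⟨z - b, norm_pos_iff.1 (heq ▸ hρ), heq⟩
      exact absurd (hzb.trans_lt ((hinner b ρ hρ').1 hmem)) heq.not_lt
    · exact hzb.trans hle

end Identification

/-! ## Segments, convexity and the two topologies -/

/-- The geodesic segment between two points `a` and `b` of a metric space, as the set of the points
on a geodesic from `a` to `b`: the image of an isometric embedding of the interval `[0, dist a b]`
with end points `a` and `b` (which exists and is unique in a real tree). -/
def geodesicSegment {X : Type*} [MetricSpace X] (a b : X) : Set X :=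
  {c | ∃ γ : ℝ → X, γ 0 = a ∧ γ (dist a b) = b ∧
    (∀ s ∈ Icc 0 (dist a b), ∀ t ∈ Icc 0 (dist a b), dist (γ s) (γ t) = |s - t|) ∧
    c ∈ γ '' Icc 0 (dist a b)}

section Statement

variable (K : Type*) [NormedField K] [IsUltrametricDist K] [AdmissibleField K]

/-- The weak topology: the original topology of the Berkovich projective line. -/
abbrev weakTopology : TopologicalSpace (BerkLine K) := inferInstance

/-- The fine topology: the topology of the metric space `(𝒜'_K, Δ)`, transported by the
identification `ι`. -/
noncomputable abbrev fineTopology : TopologicalSpace (BerkLine K) :=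
  TopologicalSpace.coinduced (iota (K := K)) inferInstance

variable {K}

/-- The geodesic segments of the Berkovich projective line: the images by `ι` of the geodesic
segments `[S, T]` of the tree `(𝒜'_K, Δ)`. -/
def IsSegment (ℓ : Set (BerkLine K)) (p q : BerkLine K) : Prop :=
  ∃ S T : ProjTree K, iota S = p ∧ iota T = q ∧ ℓ = iota '' geodesicSegment S T

/-- A subset is convex if it contains the geodesic segments between its points. -/
def IsGeodesicallyConvex (V : Set (BerkLine K)) : Prop :=
  ∀ p ∈ V, ∀ q ∈ V, ∀ ℓ, IsSegment ℓ p q → ℓ ⊆ V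

/-- For the topology `τ`, there is a topological arc from `p` to `q` contained in `V`. -/
def JoinedByArc (τ : TopologicalSpace (BerkLine K)) (V : Set (BerkLine K)) (p q : BerkLine K) :
    Prop :=
  ∃ γ : Icc (0 : ℝ) 1 → BerkLine K, @IsEmbedding _ _ _ τ γ ∧ γ 0 = p ∧ γ 1 = q ∧ ∀ t, γ t ∈ V

end Statement

end BerkovichLine

/-!
Root the tree `𝒜'_K` at the Gauss point, and let the height of the join of two points be
`chordalSup`. It satisfies `h(x, z) ≤ max (h(x, y), h(y, z))`, and `Δ` is the length of the path
through the join, so everything about segments follows from this inequality.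

Every function `chordalSup P` is continuous for the weak topology: for `P = [a, r]` it is expressed
by the functions `S ↦ sup {S, b}` with `b ∈ K`, whose sublevel and superlevel sets are unions of
balls, and in general it is a uniform limit of such functions. Hence removing an interior point of
a segment separates the endpoints even in the weak topology, and a weakly connected set is convex.

The map `ι` is injective because the functions `chordalSup P` separate points. It is surjective
because along an ultrafilter containing a ball of `K` the functions `z ↦ |z - a|` converge to
`a ↦ sup {S, a}` for some `S` in the tree, while all other ultrafilters converge to `∞`. Finally, a
segment is compact for the fine topology, so the coarser Hausdorff weak topology agrees with it
there.
-/

namespace BerkovichLine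

open Set Filter Topology UniformSpace

section JoinHeight

variable {X : Type*} {h : X → X → ℝ} {c p q x y z : X}

/-- `h x y` is the height of the join of `x` and `y` in a tree whose root is at the top: two points
above a third one are comparable, and `h x x` is the height of `x` itself. -/
structure IsJoinHeight (h : X → X → ℝ) : Prop where
  comm (x y : X) : h x y = h y x
  le_max (x y z : X) : h x z ≤ max (h x y) (h y z)
  eq_of_eq_self (x y : X) : h x y = h x x → h x y = h y y → x = y

/-- In the tree with join height `h`, the point `p` lies on the branch going up from `x`. -/
def IsAbove (h : X → X → ℝ) (p x : X) : Prop :=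
  h p x = h p p

namespace IsJoinHeight

theorem self_le_left (hh : IsJoinHeight h) (x y : X) : h x x ≤ h x y := by
  simpa [hh.comm y x] using hh.le_max x y x

theorem self_le_right (hh : IsJoinHeight h) (x y : X) : h y y ≤ h x y :=
  hh.comm x y ▸ hh.self_le_left y x

theorem height_eq_max (hh : IsJoinHeight h) (hp : IsAbove h p x) (y : X) :
    h p y = max (h p p) (h x y) := by
  have hpx : h p x = h p p := hp
  refine le_antisymm (hpx ▸ hh.le_max p x y) (max_le (hh.self_le_left p y) ?_)
  calc h x y ≤ max (h x p) (h p y) := hh.le_max x p y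
    _ = h p y := by rw [hh.comm x p, hpx, max_eq_right (hh.self_le_left p y)]

theorem height_eq_max_self (hh : IsJoinHeight h) (hp : IsAbove h p x) (hq : IsAbove h q x) :
    h p q = max (h p p) (h q q) := by
  rw [hh.height_eq_max hp, hh.comm x q, show h q x = h q q from hq]

theorem self_lt_of_isAbove_of_ne (hh : IsJoinHeight h) (hp : IsAbove h p x) (hpx : p ≠ x) :
    h x x < h p p := by
  refine lt_of_le_of_ne (hp ▸ hh.self_le_right p x) fun heq => hpx ?_
  exact hh.eq_of_eq_self p x hp (hp.trans heq.symm)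

theorem height_eq_of_isAbove (hh : IsJoinHeight h) (hp : IsAbove h p x) (hq : IsAbove h q y)
    (hpxy : h p p ≤ h x y) (hqxy : h q q ≤ h x y) : h p q = h x y := by
  rw [hh.height_eq_max hp, hh.comm x q, hh.height_eq_max hq, hh.comm y x, max_eq_right hqxy,
    max_eq_right hpxy]

theorem height_eq_of_lt (hh : IsJoinHeight h) (hxyz : h x y < h y z) : h x z = h y z := by
  refine le_antisymm ((hh.le_max x y z).trans (max_le hxyz.le le_rfl)) ?_
  have := hh.le_max y x z
  rw [hh.comm y x] at this
  exact (le_max_iff.1 this).resolve_left hxyz.not_ge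

theorem isOpen_setOf_le_diff_singleton [TopologicalSpace X] (hh : IsJoinHeight h)
    (hc : ∀ p, Continuous (h p)) (hcx : IsAbove h c x) :
    IsOpen ({p | h c c ≤ h x p} \ {c}) := by
  refine isOpen_iff_mem_nhds.2 fun p ⟨hp, hpc⟩ => ?_
  rcases (show h c c ≤ h x p from hp).lt_or_eq with hlt | heq
  · filter_upwards [(isOpen_lt continuous_const (hc x)).mem_nhds hlt] with q hq
    exact ⟨hq.le, by rintro rfl; exact hq.ne ((hh.comm x q).trans hcx).symm⟩
  · have hcp : h c p = h c c := by rw [hh.height_eq_max hcx, ← heq, max_self]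
    have hpp : h p p < h c c :=
      (hcp ▸ hh.self_le_right c p).lt_of_ne fun hpp => hpc <|
        (hh.eq_of_eq_self c p hcp (hcp.trans hpp.symm)).symm
    filter_upwards [(isOpen_lt (hc p) continuous_const).mem_nhds hpp] with q (hq : h p q < h c c)
    have hqx : h q x = h p x :=
      hh.height_eq_of_lt (by rwa [hh.comm q p, hh.comm p x, ← heq])
    refine ⟨?_, by rintro rfl; exact hq.ne ((hh.comm p q).trans hcp)⟩
    change h c c ≤ h x q
    rw [hh.comm x q, hqx, hh.comm p x, ← heq]

/-- The points strictly below `c` on the side of `x` and the remaining points other than `c` form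
two open sets. -/
theorem mem_of_isPreconnected {τ : TopologicalSpace X} (hh : IsJoinHeight h)
    (hc : ∀ p, Continuous (h p)) {V : Set X} (hV : IsPreconnected V) (hx : x ∈ V) (hy : y ∈ V)
    (hcx : IsAbove h c x) (hcy : h c y = h x y) : c ∈ V := by
  by_contra hcV
  have hxc : h x x < h c c :=
    hh.self_lt_of_isAbove_of_ne hcx fun hcx => hcV (hcx ▸ hx)
  have hcxy : h c c ≤ h x y := hcy ▸ hh.self_le_left c y
  obtain ⟨p, -, hp, hle, -⟩ := hV {p | h x p < h c c} ({p | h c c ≤ h x p} \ {c})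
    (isOpen_lt (hc x) continuous_const) (hh.isOpen_setOf_le_diff_singleton hc hcx)
    (fun p hp => (lt_or_ge (h x p) (h c c)).imp id fun hle => ⟨hle, fun hpc => hcV (hpc ▸ hp)⟩)
    ⟨x, hx, hxc⟩ ⟨y, hy, hcxy, fun hyc => hcV (hyc ▸ hy)⟩
  exact (show h x p < h c c from hp).not_ge hle

end IsJoinHeight

end JoinHeight

section Geodesic

variable {X : Type*} [MetricSpace X] {γ : ℝ → X} {c x y : X}

/-- `γ` is a geodesic from `x` to `y`, parametrized by arc length on `[0, dist x y]`. -/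
structure IsGeodesic (γ : ℝ → X) (x y : X) : Prop where
  left : γ 0 = x
  right : γ (dist x y) = y
  dist_eq : ∀ s ∈ Icc 0 (dist x y), ∀ t ∈ Icc 0 (dist x y), dist (γ s) (γ t) = |s - t|

theorem mem_geodesicSegment :
    c ∈ geodesicSegment x y ↔ ∃ γ, IsGeodesic γ x y ∧ c ∈ γ '' Icc 0 (dist x y) :=
  ⟨fun ⟨γ, h0, h1, hγ, hc⟩ => ⟨γ, ⟨h0, h1, hγ⟩, hc⟩,
    fun ⟨γ, ⟨h0, h1, hγ⟩, hc⟩ => ⟨γ, h0, h1, hγ, hc⟩⟩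

namespace IsGeodesic

theorem continuousOn (hγ : IsGeodesic γ x y) : ContinuousOn γ (Icc 0 (dist x y)) :=
  (LipschitzOnWith.of_dist_le_mul (K := 1) fun s hs t ht => by
    rw [hγ.dist_eq s hs t ht, NNReal.coe_one, one_mul, Real.dist_eq]).continuousOn

theorem injOn (hγ : IsGeodesic γ x y) : InjOn γ (Icc 0 (dist x y)) := fun s hs t ht hst =>
  sub_eq_zero.1 <| abs_eq_zero.1 <| by rw [← hγ.dist_eq s hs t ht, hst, dist_self]

theorem dist_left (hγ : IsGeodesic γ x y) {s : ℝ} (hs : s ∈ Icc 0 (dist x y)) :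
    dist x (γ s) = s := by
  rw [← hγ.left, hγ.dist_eq 0 (left_mem_Icc.2 dist_nonneg) s hs, zero_sub, abs_neg,
    abs_of_nonneg hs.1]

theorem dist_right (hγ : IsGeodesic γ x y) {s : ℝ} (hs : s ∈ Icc 0 (dist x y)) :
    dist (γ s) y = dist x y - s := by
  nth_rw 1 [← hγ.right]
  rw [hγ.dist_eq s hs _ (right_mem_Icc.2 dist_nonneg), abs_sub_comm,
    abs_of_nonneg (sub_nonneg.2 hs.2)]

theorem dist_add_dist (hγ : IsGeodesic γ x y) {s : ℝ} (hs : s ∈ Icc 0 (dist x y)) :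
    dist x (γ s) + dist (γ s) y = dist x y := by
  rw [hγ.dist_left hs, hγ.dist_right hs, add_sub_cancel]

theorem isEmbedding_comp {Y : Type*} {τ : TopologicalSpace Y} (hτ : T2Space Y) {f : X → Y}
    (hf : Continuous f) (hf' : Function.Injective f) (hγ : IsGeodesic γ x y) (hxy : x ≠ y) :
    IsEmbedding fun t : Icc (0 : ℝ) 1 => f (γ (dist x y * t)) := by
  have hmem (t : Icc (0 : ℝ) 1) : dist x y * t ∈ Icc 0 (dist x y) :=
    ⟨mul_nonneg dist_nonneg t.2.1, mul_le_of_le_one_right dist_nonneg t.2.2⟩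
  refine (Continuous.isClosedEmbedding ?_ fun s t hst => ?_).isEmbedding
  · exact hf.comp <| hγ.continuousOn.comp_continuous (by fun_prop) hmem
  · exact Subtype.ext <| mul_left_cancel₀ (dist_ne_zero.2 hxy) <|
      hγ.injOn (hmem s) (hmem t) (hf' hst)

end IsGeodesic

end Geodesic

section JoinTree

variable {X : Type*} [MetricSpace X] {h : X → X → ℝ} {c p q x y : X}

/-- A tree with join height `h` in which the branches are full intervals and the distance is the
length of the path going up from one point to the join and down to the other, a stretch of height
`t` having length `t / 2`. -/
structure IsJoinTree (h : X → X → ℝ) : Prop extends IsJoinHeight h where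
  dist_eq (x y : X) : dist x y = h x y - h x x / 2 - h y y / 2
  exists_isAbove {x y : X} {t : ℝ} : h x x ≤ t → t ≤ h x y → ∃ p, IsAbove h p x ∧ h p p = t

namespace IsJoinTree

theorem isAbove_or_isAbove (hh : IsJoinTree h) (hc : dist x c + dist c y = dist x y) :
    IsAbove h c x ∧ h c y = h x y ∨ IsAbove h c y ∧ h c x = h x y := by
  have hsum : h x c + h c y = h c c + h x y := by
    linarith [hh.dist_eq x c, hh.dist_eq c y, hh.dist_eq x y]
  have hx : h c c ≤ h x c := hh.self_le_right x c
  have hy : h c c ≤ h c y := hh.self_le_left c y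
  rw [IsAbove, IsAbove, hh.comm c x]
  rcases le_max_iff.1 (hh.le_max x c y) with hle | hle
  · exact Or.inr ⟨by linarith, by linarith⟩
  · exact Or.inl ⟨by linarith, by linarith⟩

theorem dist_of_dist_add_dist (hh : IsJoinTree h) (hp : dist x p + dist p y = dist x y)
    (hq : dist x q + dist q y = dist x y) : dist p q = |dist x p - dist x q| := by
  wlog hle : dist x p ≤ dist x q generalizing p q
  · rw [dist_comm p q, abs_sub_comm, this hq hp (le_of_not_ge hle)]
  rw [abs_sub_comm, abs_of_nonneg (sub_nonneg.2 hle)]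
  have hdist := hh.dist_eq
  have hxp : h p x = h x p := hh.comm p x
  have hxq : h q x = h x q := hh.comm q x
  rcases hh.isAbove_or_isAbove hp with ⟨hpx, hpy⟩ | ⟨hpy, hpx⟩ <;>
    rcases hh.isAbove_or_isAbove hq with ⟨hqx, hqy⟩ | ⟨hqy, hqx⟩
  · have hpq := hh.height_eq_max_self hpx hqx
    rw [IsAbove] at hpx hqx
    rw [max_eq_right (by linarith [hdist x p, hdist x q])] at hpq
    linarith [hdist x p, hdist x q, hdist p q]
  · have hpq := hh.height_eq_of_isAbove hpx hqy (hpy ▸ hh.self_le_left p y)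
      (hqx ▸ hh.self_le_left q x)
    rw [IsAbove] at hpx hqy
    linarith [hdist x p, hdist x q, hdist p q]
  · have hqp := hh.height_eq_of_isAbove hqx hpy (hqy ▸ hh.self_le_left q y)
      (hpx ▸ hh.self_le_left p x)
    rw [IsAbove] at hpy hqx
    linarith [hdist x p, hdist x q, hdist q p, dist_comm p q, dist_nonneg (x := p) (y := q)]
  · have hpq := hh.height_eq_max_self hpy hqy
    rw [IsAbove] at hpy hqy
    rw [max_eq_left (by linarith [hdist x p, hdist x q])] at hpq
    linarith [hdist p y, hdist q y, hdist p q]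

theorem eq_of_dist_eq (hh : IsJoinTree h) (hp : dist x p + dist p y = dist x y)
    (hq : dist x q + dist q y = dist x y) (hpq : dist x p = dist x q) : p = q :=
  dist_eq_zero.1 <| by rw [hh.dist_of_dist_add_dist hp hq, hpq, sub_self, abs_zero]

theorem exists_dist_eq (hh : IsJoinTree h) {s : ℝ} (hs : s ∈ Icc 0 (dist x y)) :
    ∃ p, dist x p = s ∧ dist p y = dist x y - s := by
  wlog hle : h x x + 2 * s ≤ h x y generalizing x y s
  · have hs' : dist x y - s ∈ Icc 0 (dist y x) :=
      ⟨sub_nonneg.2 hs.2, (sub_le_self _ hs.1).trans_eq (dist_comm x y)⟩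
    obtain ⟨p, hyp, hpx⟩ := this hs' (by linarith [hh.dist_eq x y, hh.comm x y])
    exact ⟨p, by linarith [dist_comm x p, dist_comm x y], by linarith [dist_comm p y]⟩
  obtain ⟨p, hpx, hp⟩ := hh.exists_isAbove (by linarith [hs.1]) hle
  have hpy : h p y = h x y := by rw [hh.height_eq_max hpx, hp, max_eq_right hle]
  have hxp : h x p = h p p := (hh.comm x p).trans hpx
  exact ⟨p, by linarith [hh.dist_eq x p], by linarith [hh.dist_eq p y, hh.dist_eq x y]⟩

theorem exists_isGeodesic (hh : IsJoinTree h) (x y : X) : ∃ γ, IsGeodesic γ x y := by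
  have : Nonempty X := ⟨x⟩
  choose! γ hxγ hγy using fun s hs => hh.exists_dist_eq (x := x) (y := y) (s := s) hs
  refine ⟨γ, ?_, ?_, fun s hs t ht => ?_⟩
  · exact (dist_eq_zero.1 (hxγ 0 (left_mem_Icc.2 dist_nonneg))).symm
  · exact dist_eq_zero.1 ((hγy _ (right_mem_Icc.2 dist_nonneg)).trans (sub_self _))
  · rw [hh.dist_of_dist_add_dist (x := x) (y := y) (by rw [hxγ s hs, hγy s hs]; ring)
      (by rw [hxγ t ht, hγy t ht]; ring), hxγ s hs, hxγ t ht]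

theorem mem_geodesicSegment_iff (hh : IsJoinTree h) :
    c ∈ geodesicSegment x y ↔ dist x c + dist c y = dist x y := by
  rw [mem_geodesicSegment]
  constructor
  · rintro ⟨γ, hγ, s, hs, rfl⟩
    exact hγ.dist_add_dist hs
  · intro hc
    obtain ⟨γ, hγ⟩ := hh.exists_isGeodesic x y
    have hs : dist x c ∈ Icc 0 (dist x y) := ⟨dist_nonneg, hc ▸ le_add_of_nonneg_right dist_nonneg⟩
    exact ⟨γ, hγ, dist x c, hs,
      hh.eq_of_dist_eq (hγ.dist_add_dist hs) hc (hγ.dist_left hs)⟩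

theorem left_mem_geodesicSegment (hh : IsJoinTree h) (x y : X) : x ∈ geodesicSegment x y :=
  hh.mem_geodesicSegment_iff.2 (by rw [dist_self, zero_add])

theorem right_mem_geodesicSegment (hh : IsJoinTree h) (x y : X) : y ∈ geodesicSegment x y :=
  hh.mem_geodesicSegment_iff.2 (by rw [dist_self, add_zero])

theorem geodesicSegment_eq_image (hh : IsJoinTree h) {γ : ℝ → X} (hγ : IsGeodesic γ x y) :
    geodesicSegment x y = γ '' Icc 0 (dist x y) := by
  refine Subset.antisymm (fun c hc => ?_) fun c hc => mem_geodesicSegment.2 ⟨γ, hγ, hc⟩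
  obtain ⟨γ', hγ', s, hs, rfl⟩ := mem_geodesicSegment.1 hc
  exact ⟨s, hs, hh.eq_of_dist_eq (hγ.dist_add_dist hs) (hγ'.dist_add_dist hs)
    ((hγ.dist_left hs).trans (hγ'.dist_left hs).symm)⟩

theorem isCompact_geodesicSegment (hh : IsJoinTree h) (x y : X) :
    IsCompact (geodesicSegment x y) := by
  obtain ⟨γ, hγ⟩ := hh.exists_isGeodesic x y
  exact hh.geodesicSegment_eq_image hγ ▸ isCompact_Icc.image_of_continuousOn hγ.continuousOn

theorem isPreconnected_geodesicSegment (hh : IsJoinTree h) (x y : X) :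
    IsPreconnected (geodesicSegment x y) := by
  obtain ⟨γ, hγ⟩ := hh.exists_isGeodesic x y
  exact hh.geodesicSegment_eq_image hγ ▸ isPreconnected_Icc.image γ hγ.continuousOn

theorem geodesicSegment_subset_of_isPreconnected (hh : IsJoinTree h) {τ : TopologicalSpace X}
    (hc : ∀ p, Continuous[τ, _] (h p)) {V : Set X} (hV : @IsPreconnected X τ V) (hx : x ∈ V)
    (hy : y ∈ V) : geodesicSegment x y ⊆ V := fun c hcxy => by
  rcases hh.isAbove_or_isAbove (hh.mem_geodesicSegment_iff.1 hcxy) with ⟨hcx, hcy⟩ | ⟨hcy, hcx⟩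
  · exact hh.mem_of_isPreconnected hc hV hx hy hcx hcy
  · exact hh.mem_of_isPreconnected hc hV hy hx hcy (hcx.trans (hh.comm x y))

end IsJoinTree

end JoinTree

section Tree

variable {K : Type*} [NormedField K] [IsUltrametricDist K]

namespace Tree

theorem isJoinHeight_sup : IsJoinHeight (sup (K := K)) where
  comm := sup_comm
  le_max := sup_triangle
  eq_of_eq_self S T hS hT := by
    rw [sup_self] at hS hT
    exact dist_eq_zero.1 (by linarith [show sup S T = dist S T + (diam S + diam T) / 2 from rfl])

theorem sup_nonneg (S T : Tree K) : 0 ≤ sup S T :=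
  (diam_nonneg S).trans (diam_le_sup S T)

theorem sup_ofField_ofField (a b : K) : sup (ofField a) (ofField b) = ‖a - b‖ :=
  (sup_coe _ _).trans (by simp [BallPair.sup])

theorem diam_mk (a : K) (r : ℝ) (hr : 0 ≤ r) : diam (mk a r hr) = r := diam_coe _

theorem sup_mk (S : Tree K) (a : K) (r : ℝ) (hr : 0 ≤ r) :
    sup S (mk a r hr) = max (sup S (ofField a)) r := by
  refine Completion.induction_on S (isClosed_eq (by fun_prop) (by fun_prop)) fun p => ?_
  rw [ofField, mk, mk, sup_coe, sup_coe]
  simp only [BallPair.sup, max_eq_left p.radius_nonneg]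
  exact max_right_comm _ _ _

theorem exists_mk_isAbove {S : Tree K} {r : ℝ} (hS : diam S < r) :
    ∃ (a : K) (hr : 0 ≤ r), IsAbove sup (mk a r hr) S := by
  obtain ⟨p, hp⟩ := Completion.denseRange_coe.exists_mem_open
    (isOpen_lt (f := sup S) (by fun_prop) continuous_const) ⟨S, (sup_self S).trans_lt hS⟩
  have hp : sup S (mk p.center p.radius p.radius_nonneg) < r := hp
  rw [sup_mk] at hp
  refine ⟨p.center, (diam_nonneg S).trans hS.le, ?_⟩
  rw [IsAbove, sup_self, diam_mk, sup_comm, sup_mk, max_eq_right ((le_max_left _ _).trans hp.le)]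

theorem max_one_abs_eq_of_isAbove {P S : Tree K} (hP : IsAbove sup P S)
    (hPS : diam P ≤ max 1 S.abs) : max 1 P.abs = max 1 S.abs := by
  rw [max_one_abs P, max_one_abs S, isJoinHeight_sup.height_eq_max hP, sup_self, ← max_one_abs,
    max_eq_right hPS]

end Tree

namespace ProjTree

theorem isJoinHeight_chordalSup : IsJoinHeight (chordalSup (K := K)) where
  comm := chordalSup_comm
  le_max := chordalSup_triangle
  eq_of_eq_self S T hS hT := eq_of_chordalDist_eq_zero S T (by rw [chordalDist]; linarith)

theorem chordalSup_nonneg (S T : ProjTree K) : 0 ≤ chordalSup S T := by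
  cases S <;> cases T <;> simp only [chordalSup, le_refl]
  · positivity
  · positivity
  · exact div_nonneg (Tree.sup_nonneg _ _) (by positivity)

theorem chordalSup_mk_zero {R : ℝ} (hR : 1 ≤ R) (T : ProjTree K) :
    chordalSup (of (Tree.mk 0 R (zero_le_one.trans hR))) T = max R⁻¹ (chordalSup infty T) := by
  have hR0 : 0 < R := one_pos.trans_le hR
  have habs : max 1 (Tree.mk (0 : K) R hR0.le).abs = R := by
    rw [Tree.abs_mk, norm_zero, max_eq_right hR0.le, max_eq_right hR]
  cases T with
  | infty => rw [chordalSup, chordalSup, habs, one_div, max_eq_left (inv_nonneg.2 hR0.le)]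
  | of T =>
    have hT : 0 < max 1 T.abs := by positivity
    have hsup : (Tree.mk 0 R hR0.le).sup T = max (max 1 T.abs) R := by
      rw [Tree.sup_comm, Tree.sup_mk, ← Tree.abs, max_right_comm, max_eq_right hR, max_comm]
    rw [chordalSup, chordalSup, habs, hsup]
    rw [← max_div_div_right (by positivity), div_mul_cancel_left₀ hR0.ne',
      div_mul_cancel_right₀ hT.ne', one_div, max_comm]

/-- The Gauss point `[0, 1]` is the root. -/
theorem chordalSup_le_one (S T : ProjTree K) : chordalSup S T ≤ 1 := by
  have hinfty (T : ProjTree K) : chordalSup infty T ≤ 1 := by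
    cases T with
    | infty => exact zero_le_one
    | of T => exact div_le_one_of_le₀ (le_max_left _ _) (by positivity)
  have hroot (T : ProjTree K) : chordalSup (of (Tree.mk 0 1 zero_le_one)) T = 1 := by
    rw [chordalSup_mk_zero le_rfl, inv_one, max_eq_left (hinfty T)]
  calc chordalSup S T
      ≤ max (chordalSup S (of (Tree.mk 0 1 zero_le_one)))
          (chordalSup (of (Tree.mk 0 1 zero_le_one)) T) := chordalSup_triangle S _ T
    _ = 1 := by rw [chordalSup_comm S, hroot, hroot, max_self]

theorem exists_mk_isAbove {S : ProjTree K} {t : ℝ} (hS : chordalSup S S < t) (ht : t ≤ 1) :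
    ∃ (a : K) (r : ℝ) (hr : 0 ≤ r), IsAbove chordalSup (of (Tree.mk a r hr)) S ∧
      chordalSup (of (Tree.mk a r hr)) (of (Tree.mk a r hr)) = t := by
  have ht0 : 0 < t := (chordalSup_nonneg S S).trans_lt hS
  rcases le_or_gt (chordalSup infty S) t with hle | hlt
  · have hinv : 1 ≤ t⁻¹ := (one_le_inv₀ ht0).2 ht
    have hself : chordalSup (of (Tree.mk (0 : K) t⁻¹ (zero_le_one.trans hinv)))
        (of (Tree.mk 0 t⁻¹ (zero_le_one.trans hinv))) = t := by
      rw [chordalSup_mk_zero hinv, chordalSup_comm, chordalSup_mk_zero hinv, inv_inv]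
      simp only [chordalSup, max_eq_left ht0.le, max_self]
    refine ⟨0, t⁻¹, zero_le_one.trans hinv, ?_, hself⟩
    rw [IsAbove, hself, chordalSup_mk_zero hinv, inv_inv, max_eq_left hle]
  · cases S with
    | infty => exact absurd hlt ht0.not_gt
    | of S =>
      have hm : 0 < max 1 S.abs := by positivity
      rw [chordalSup, Tree.sup_self, div_lt_iff₀ (by positivity)] at hS
      rw [chordalSup, lt_div_iff₀ hm] at hlt
      obtain ⟨a, hr, ha⟩ := Tree.exists_mk_isAbove hS
      have hdiam : (Tree.mk a _ hr).diam = t * (max 1 S.abs * max 1 S.abs) := Tree.diam_mk _ _ _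
      have habs := Tree.max_one_abs_eq_of_isAbove ha (by rw [hdiam]; nlinarith)
      rw [IsAbove, Tree.sup_self, hdiam] at ha
      refine ⟨a, _, hr, ?_, ?_⟩
      · rw [IsAbove, chordalSup, chordalSup, habs, ha, Tree.sup_self, hdiam]
      · rw [chordalSup, habs, Tree.sup_self, hdiam, mul_div_cancel_right₀ _ (by positivity)]

theorem isJoinTree_chordalSup : IsJoinTree (chordalSup (K := K)) where
  toIsJoinHeight := isJoinHeight_chordalSup
  dist_eq _ _ := rfl
  exists_isAbove {S T t} hS hT := by
    rcases hS.eq_or_lt with rfl | hlt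
    · exact ⟨S, rfl, rfl⟩
    · obtain ⟨a, r, hr, hP⟩ := exists_mk_isAbove hlt (hT.trans (chordalSup_le_one S T))
      exact ⟨_, hP⟩

end ProjTree

end Tree

section WeakTopology

variable {K : Type*} [NormedField K] [IsUltrametricDist K] [AdmissibleField K]

/-- The weak topology read on the tree `𝒜'_K` through the identification `ι`. -/
noncomputable abbrev ProjTree.weakTopology : TopologicalSpace (ProjTree K) :=
  TopologicalSpace.induced iota inferInstance

/-- The topology induced on `𝒜_K` by the weak topology. -/
noncomputable abbrev Tree.weakTopology : TopologicalSpace (Tree K) :=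
  TopologicalSpace.induced ProjTree.of ProjTree.weakTopology

theorem isOpen_setOf_mem_minimalFilter (U : Set (ProjLine K)) :
    IsOpen {p : BerkLine K | U ∈ minimalFilter p} := by
  refine isOpen_iff_mem_nhds.2 fun p ⟨W, hW, hWU⟩ => ?_
  filter_upwards [eventually_mem_nhds_iff.2 hW] with q hq using ⟨W, hq, hWU⟩

theorem OpenBall.isOpen_treeSet_weakTopology (D : OpenBall K) :
    IsOpen[ProjTree.weakTopology] D.treeSet :=
  ⟨_, isOpen_setOf_mem_minimalFilter D.toSet, ext fun _ => toSet_mem_minimalFilter_iota⟩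

theorem exists_mem_valueGroup_of_nonneg {s t : ℝ} (hs : 0 ≤ s) (hst : s < t) :
    ∃ r ∈ valueGroup K, s < r ∧ r < t := by
  obtain ⟨u, hsu, hut⟩ := exists_between hst
  obtain ⟨r, hr, hur, hrt⟩ := exists_mem_valueGroup (K := K) (hs.trans_lt hsu) hut
  exact ⟨r, hr, hsu.trans hur, hrt⟩

theorem Tree.isOpen_weakTopology_sup_lt (a : K) {r : ℝ} (hr : r ∈ valueGroup K) :
    IsOpen[Tree.weakTopology] {T : Tree K | T.sup (Tree.ofField a) < r} :=
  ⟨_, OpenBall.isOpen_treeSet_weakTopology ⟨a, r, hr, false⟩,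
    ext fun _ => OpenBall.of_mem_inner (hr := hr)⟩

theorem Tree.isOpen_weakTopology_lt_sup (a : K) {r : ℝ} (hr : r ∈ valueGroup K) :
    IsOpen[Tree.weakTopology] {T : Tree K | r < T.sup (Tree.ofField a)} :=
  ⟨_, OpenBall.isOpen_treeSet_weakTopology ⟨a, r, hr, true⟩,
    ext fun _ => OpenBall.of_mem_outer (hr := hr)⟩

theorem Tree.continuous_weakTopology_sup_ofField (a : K) :
    Continuous[Tree.weakTopology, _] fun T : Tree K => T.sup (Tree.ofField a) := by
  let _ : TopologicalSpace (Tree K) := Tree.weakTopology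
  refine OrderTopology.continuous_iff.2 fun x => ⟨?_, ?_⟩
  · rcases lt_or_ge x 0 with hx | hx
    · convert isOpen_univ
      exact eq_univ_of_forall fun T => hx.trans_le (Tree.sup_nonneg T _)
    · refine isOpen_iff_forall_mem_open.2 fun T hT => ?_
      obtain ⟨r, hr, hxr, hrT⟩ := exists_mem_valueGroup_of_nonneg (K := K) hx hT
      exact ⟨_, fun U => hxr.trans, Tree.isOpen_weakTopology_lt_sup a hr, hrT⟩
  · refine isOpen_iff_forall_mem_open.2 fun T hT => ?_
    obtain ⟨r, hr, hTr, hrx⟩ := exists_mem_valueGroup_of_nonneg (K := K) (Tree.sup_nonneg T _) hT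
    exact ⟨_, fun U hU => lt_trans hU hrx, Tree.isOpen_weakTopology_sup_lt a hr, hTr⟩

namespace ProjTree

theorem isOpenEmbedding_of_weakTopology :
    @IsOpenEmbedding _ _ Tree.weakTopology ProjTree.weakTopology
      (ProjTree.of : Tree K → ProjTree K) := by
  let _ : TopologicalSpace (Tree K) := Tree.weakTopology
  let _ : TopologicalSpace (ProjTree K) := ProjTree.weakTopology
  refine ⟨⟨⟨rfl⟩, fun S T => ?_⟩, isOpen_iff_forall_mem_open.2 ?_⟩
  · exact ProjTree.of.inj
  · rintro _ ⟨S, rfl⟩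
    obtain ⟨r, hr, hSr, -⟩ := exists_mem_valueGroup_of_nonneg (K := K)
      (Tree.sup_nonneg S (Tree.ofField 0)) (lt_add_one _)
    refine ⟨_, fun T hT => ?_, OpenBall.isOpen_treeSet_weakTopology ⟨0, r, hr, false⟩,
      OpenBall.of_mem_inner.2 hSr⟩
    cases T with
    | infty => exact absurd hT OpenBall.tree_infty_notMem_inner
    | of T => exact mem_range_self T

theorem eventually_weakTopology_chordalSup_infty_lt {ε : ℝ} (hε : 0 < ε) :
    ∀ᶠ T in @nhds _ weakTopology (infty : ProjTree K), chordalSup T infty < ε := by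
  let _ : TopologicalSpace (ProjTree K) := ProjTree.weakTopology
  obtain ⟨r, hr, hεr, -⟩ := exists_mem_valueGroup (K := K) (inv_pos.2 hε) (lt_add_one _)
  filter_upwards [(OpenBall.isOpen_treeSet_weakTopology ⟨0, r, hr, true⟩).mem_nhds
    OpenBall.tree_infty_mem_outer] with T hT
  cases T with
  | infty => exact hε
  | of T =>
    have hT : r < T.abs := OpenBall.of_mem_outer.1 hT
    rw [chordalSup, one_div]
    exact inv_lt_of_inv_lt₀ hε ((hεr.trans hT).trans_le (le_max_right 1 T.abs))

theorem continuous_weakTopology_chordalSup_mk (a : K) (r : ℝ) (hr : 0 ≤ r) :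
    Continuous[weakTopology, _] (chordalSup (of (Tree.mk a r hr))) := by
  let _ : TopologicalSpace (Tree K) := Tree.weakTopology
  let _ : TopologicalSpace (ProjTree K) := ProjTree.weakTopology
  refine continuous_iff_continuousAt.2 fun S => ?_
  cases S with
  | infty =>
    refine (tendsto_const_nhds (x := chordalSup _ infty)).congr' ?_
    have hpos : 0 < chordalSup infty (of (Tree.mk a r hr)) := by
      rw [chordalSup]; positivity
    filter_upwards [eventually_weakTopology_chordalSup_infty_lt hpos] with T hT
    rw [chordalSup_comm _ T, isJoinHeight_chordalSup.height_eq_of_lt hT, chordalSup_comm]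
  | of S =>
    rw [← isOpenEmbedding_of_weakTopology.continuousAt_iff]
    have hsup : chordalSup (of (Tree.mk a r hr)) ∘ of = fun T : Tree K =>
        max (T.sup (Tree.ofField a)) r /
          (max 1 (Tree.mk a r hr).abs * max 1 (T.sup (Tree.ofField 0))) := by
      funext T
      rw [Function.comp_apply, chordalSup, Tree.sup_comm, Tree.sup_mk, ← Tree.abs]
    rw [hsup]
    refine Continuous.continuousAt (Continuous.div ?_ ?_ fun T => by positivity)
    · exact (Tree.continuous_weakTopology_sup_ofField a).max continuous_const
    · exact continuous_const.mul
        (continuous_const.max (Tree.continuous_weakTopology_sup_ofField 0))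

/-- Moving `P` up by a small height changes `chordalSup P` uniformly little. -/
theorem continuous_weakTopology_chordalSup (P : ProjTree K) :
    Continuous[weakTopology, _] (chordalSup P) := by
  let _ : TopologicalSpace (ProjTree K) := ProjTree.weakTopology
  have hP := isJoinHeight_chordalSup.self_le_left P
  rcases (chordalSup_le_one P P).eq_or_lt with heq | hlt
  · convert (continuous_const : Continuous fun _ : ProjTree K => (1 : ℝ)) using 1
    exact funext fun T => (chordalSup_le_one P T).antisymm (heq ▸ hP T)
  refine continuous_of_uniform_approx_of_continuous fun u hu => ?_
  obtain ⟨ε, hε, hεu⟩ := Metric.mem_uniformity_dist.1 hu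
  obtain ⟨t, ht, ht'⟩ := exists_between (lt_min hlt (lt_add_of_pos_right (chordalSup P P) hε))
  obtain ⟨a, r, hr, hQP, hQ⟩ := exists_mk_isAbove ht (ht'.le.trans (min_le_left _ _))
  refine ⟨_, continuous_weakTopology_chordalSup_mk a r hr, fun T => hεu ?_⟩
  rw [isJoinHeight_chordalSup.height_eq_max hQP, hQ, dist_comm, Real.dist_eq, abs_of_nonneg
    (sub_nonneg.2 (le_max_right _ _)), sub_lt_iff_lt_add, max_lt_iff]
  constructor <;> linarith [hP T, min_le_right 1 (chordalSup P P + ε)]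

end ProjTree

end WeakTopology

section Bijective

variable {K : Type*} [NormedField K] [IsUltrametricDist K]

theorem Tree.exists_sup_ofField_eq {s : K → ℝ} (hs : ∀ a b, s a ≤ max (s b) ‖a - b‖)
    (hs' : ∀ a b, ‖a - b‖ ≤ max (s a) (s b)) : ∃ S : Tree K, ∀ a, S.sup (ofField a) = s a := by
  have hs0 (a : K) : 0 ≤ s a := by simpa using hs' a a
  have hbdd : BddBelow (range s) := ⟨0, by rintro _ ⟨a, rfl⟩; exact hs0 a⟩
  have hsup (a b : K) : (mk a (s a) (hs0 a)).sup (ofField b) = max (s a) (s b) := by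
    rw [sup_comm, sup_mk, sup_ofField_ofField, norm_sub_rev, max_comm]
    exact le_antisymm (max_le (le_max_left _ _) (hs' a b))
      (max_le (le_max_left _ _) (norm_sub_rev a b ▸ hs b a))
  have hdist (a b : K) : dist (mk a (s a) (hs0 a)) (mk b (s b) (hs0 b)) ≤ dist (s a) (s b) := by
    have hmax : (mk a (s a) (hs0 a)).sup (mk b (s b) (hs0 b)) = max (s a) (s b) := by
      rw [sup_mk, hsup, max_eq_left (le_max_right _ _)]
    rw [sup, diam_mk, diam_mk] at hmax
    rw [Real.dist_eq]
    linarith [max_sub_min_eq_abs' (s a) (s b), min_add_max (s a) (s b), abs_nonneg (s a - s b)]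
  obtain ⟨u, -, hu, hmem⟩ := exists_seq_tendsto_sInf (range_nonempty s) hbdd
  choose a ha using hmem
  obtain rfl : s ∘ a = u := funext ha
  obtain ⟨S, hS⟩ := cauchySeq_tendsto_of_complete (u := fun n => mk (a n) (s (a n)) (hs0 _)) <|
    Metric.cauchySeq_iff.2 fun ε hε => by
      obtain ⟨N, hN⟩ := Metric.cauchySeq_iff.1 hu.cauchySeq ε hε
      exact ⟨N, fun m hm n hn => (hdist _ _).trans_lt (hN m hm n hn)⟩
  refine ⟨S, fun b => ?_⟩
  have hcont : Continuous fun T : Tree K => T.sup (ofField b) := by fun_prop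
  refine tendsto_nhds_unique ((hcont.tendsto S).comp hS) ?_
  simpa only [Function.comp_def, hsup, max_eq_right (csInf_le hbdd (mem_range_self b))]
    using hu.max (tendsto_const_nhds (x := s b))

theorem Tree.exists_tendsto_norm_sub {G : Ultrafilter K} {c : K} {r : ℝ}
    (hG : ∀ᶠ z in G, ‖z - c‖ ≤ r) :
    ∃ S : Tree K, ∀ a, Tendsto (fun z => ‖z - a‖) G (𝓝 (S.sup (ofField a))) := by
  have hlim (a : K) : ∃ s, Tendsto (fun z => ‖z - a‖) G (𝓝 s) := by
    obtain ⟨s, -, hs⟩ := isCompact_Icc.ultrafilter_le_nhds' (G.map fun z => ‖z - a‖)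
      (s := Icc 0 (max r ‖c - a‖)) <| Ultrafilter.mem_map.2 <| by
        filter_upwards [hG] with z hz
        refine ⟨norm_nonneg _, ?_⟩
        calc ‖z - a‖ = ‖(z - c) + (c - a)‖ := by rw [sub_add_sub_cancel]
          _ ≤ max ‖z - c‖ ‖c - a‖ := IsUltrametricDist.norm_add_le_max _ _
          _ ≤ max r ‖c - a‖ := max_le_max_right _ hz
    exact ⟨s, hs⟩
  choose s hs using hlim
  obtain ⟨S, hS⟩ := exists_sup_ofField_eq (s := s)
    (fun a b => le_of_tendsto_of_tendsto' (hs a) ((hs b).max tendsto_const_nhds) fun z => by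
      rw [norm_sub_rev a b, ← sub_add_sub_cancel z b a]
      exact IsUltrametricDist.norm_add_le_max _ _)
    (fun a b => ge_of_tendsto' ((hs a).max (hs b)) fun z => by
      rw [norm_sub_rev, ← sub_sub_sub_cancel_left a b z]
      exact norm_sub_le_max' _ _)
  exact ⟨S, fun a => (hS a).symm ▸ hs a⟩

theorem le_ballFilter_iff {G : Filter (ProjLine K)} {S : ProjTree K} :
    G ≤ ballFilter S ↔ ∀ D : OpenBall K, S ∈ D.treeSet → D.toSet ∈ G :=
  Filter.le_generate_iff.trans ⟨fun h D hD => h ⟨D, hD, rfl⟩, fun h _ ⟨D, hD, hB⟩ => hB ▸ h D hD⟩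

theorem tendsto_ofField_ballFilter {G : Filter K} {S : Tree K}
    (hS : ∀ a, Tendsto (fun z => ‖z - a‖) G (𝓝 (S.sup (Tree.ofField a)))) :
    Tendsto ProjLine.ofField G (ballFilter (ProjTree.of S)) := by
  refine le_ballFilter_iff.2 fun ⟨a, r, hr, outer⟩ hD => ?_
  rw [mem_map]
  cases outer
  · filter_upwards [(hS a).eventually_lt_const (OpenBall.of_mem_inner.1 hD)] with z hz
    exact (OpenBall.ofField_mem_inner (hr := hr)).2 hz
  · filter_upwards [(hS a).eventually_const_lt (OpenBall.of_mem_outer.1 hD)] with z hz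
    exact (OpenBall.ofField_mem_outer (hr := hr)).2 hz

theorem exists_le_ballFilter (G : Ultrafilter (ProjLine K)) :
    ∃ S : ProjTree K, (G : Filter (ProjLine K)) ≤ ballFilter S := by
  by_cases hG : ∃ (c : K) (r : ℝ), ProjLine.ofField '' {z | ‖z - c‖ ≤ r} ∈ G
  · obtain ⟨c, r, hcr⟩ := hG
    have hrange : range ProjLine.ofField ∈ G := mem_of_superset hcr (image_subset_range _ _)
    obtain ⟨S, hS⟩ := Tree.exists_tendsto_norm_sub
      ((G.mem_comap ProjLine.ofField_injective hrange).2 hcr)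
    refine ⟨ProjTree.of S, ?_⟩
    rw [← Filter.map_comap_of_mem hrange, ← G.coe_comap ProjLine.ofField_injective hrange]
    exact tendsto_ofField_ballFilter hS
  · push Not at hG
    refine ⟨ProjTree.infty, le_ballFilter_iff.2 fun ⟨a, r, hr, outer⟩ hD => ?_⟩
    cases outer
    · exact absurd hD OpenBall.tree_infty_notMem_inner
    · exact Ultrafilter.compl_mem_iff_notMem.2 (hG a r)

variable [AdmissibleField K]

theorem iota_injective : Function.Injective (iota (K := K)) := by
  intro S T hST
  let _ : TopologicalSpace (ProjTree K) := ProjTree.weakTopology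
  have hins : Inseparable S T := IsInducing.inseparable_iff ⟨rfl⟩ |>.1 (.of_eq hST)
  have hsup (P : ProjTree K) : P.chordalSup S = P.chordalSup T :=
    (hins.map (ProjTree.continuous_weakTopology_chordalSup P)).eq
  refine ProjTree.isJoinHeight_chordalSup.eq_of_eq_self S T (hsup S).symm ?_
  rw [ProjTree.chordalSup_comm, hsup]

theorem iota_surjective : Function.Surjective (iota (K := K)) := by
  intro p
  have : (Filter.comap ((↑) : ProjLine K → BerkLine K) (𝓝 p)).NeBot :=
    Completion.isDenseInducing_coe.comap_nhds_neBot p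
  let G := Ultrafilter.of (Filter.comap ((↑) : ProjLine K → BerkLine K) (𝓝 p))
  obtain ⟨S, hS⟩ := exists_le_ballFilter G
  have hGS : Tendsto ((↑) : ProjLine K → BerkLine K) G (𝓝 (iota S)) :=
    tendsto_iff_comap.2 (hS.trans (ballFilter_le_minimalFilter S))
  have hGp : Tendsto ((↑) : ProjLine K → BerkLine K) G (𝓝 p) :=
    tendsto_iff_comap.2 (Ultrafilter.of_le _)
  exact ⟨S, tendsto_nhds_unique hGS hGp⟩

end Bijective

section Convex

theorem induced_subtypeVal_eq_of_le {X : Type*} {τ τ' : TopologicalSpace X} (hle : τ ≤ τ')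
    (hτ' : @T2Space X τ') {s : Set X} (hs : @IsCompact X τ s) :
    TopologicalSpace.induced (Subtype.val : s → X) τ =
      TopologicalSpace.induced (Subtype.val : s → X) τ' := by
  let _ : TopologicalSpace s := TopologicalSpace.induced Subtype.val τ
  have : CompactSpace s := (@isCompact_iff_compactSpace X τ s).1 hs
  have hcont : Continuous[_, τ'] (Subtype.val : s → X) :=
    continuous_iff_le_induced.2 (induced_mono hle)
  exact (hcont.isClosedEmbedding Subtype.val_injective).eq_induced

theorem isPreconnected_of_le {X : Type*} {τ τ' : TopologicalSpace X} (hle : τ ≤ τ') {s : Set X}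
    (hs : @IsPreconnected X τ s) : @IsPreconnected X τ' s :=
  fun u v hu hv => hs u v (hle u hu) (hle v hv)

variable {K : Type*} [NormedField K] [IsUltrametricDist K] [AdmissibleField K]
  {V : Set (BerkLine K)} {p q : BerkLine K}

theorem fineTopology_le_weakTopology : fineTopology K ≤ weakTopology K :=
  coinduced_le_iff_le_induced.2 continuous_iota.le_induced

theorem IsSegment.induced_weakTopology_eq {ℓ : Set (BerkLine K)} (hℓ : IsSegment ℓ p q) :
    TopologicalSpace.induced (Subtype.val : ℓ → BerkLine K) (weakTopology K) =
      TopologicalSpace.induced (Subtype.val : ℓ → BerkLine K) (fineTopology K) := by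
  obtain ⟨S, T, -, -, rfl⟩ := hℓ
  refine (induced_subtypeVal_eq_of_le fineTopology_le_weakTopology inferInstance ?_).symm
  exact @IsCompact.image _ _ _ (fineTopology K) _ _
    (ProjTree.isJoinTree_chordalSup.isCompact_geodesicSegment S T) continuous_coinduced_rng

theorem isGeodesicallyConvex_iff :
    IsGeodesicallyConvex V ↔
      ∀ S T : ProjTree K, iota S ∈ V → iota T ∈ V → geodesicSegment S T ⊆ iota ⁻¹' V :=
  ⟨fun hV S T hS hT => image_subset_iff.1 (hV _ hS _ hT _ ⟨S, T, rfl, rfl, rfl⟩),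
    fun hV _ hp _ hq _ ⟨S, T, hS, hT, hℓ⟩ =>
      hℓ ▸ image_subset_iff.2 (hV S T (hS.symm ▸ hp) (hT.symm ▸ hq))⟩

theorem isGeodesicallyConvex_sInter {𝒱 : Set (Set (BerkLine K))}
    (h : ∀ V ∈ 𝒱, IsGeodesicallyConvex V) : IsGeodesicallyConvex (⋂₀ 𝒱) :=
  fun p hp q hq ℓ hℓ => subset_sInter fun V hV => h V hV p (hp V hV) q (hq V hV) ℓ hℓ

theorem IsGeodesicallyConvex.isPreconnected {τ : TopologicalSpace (BerkLine K)}
    (hτ : Continuous[_, τ] (iota (K := K))) (hV : IsGeodesicallyConvex V) :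
    @IsPreconnected _ τ V := by
  refine isPreconnected_of_forall_pair fun p hp q hq => ?_
  obtain ⟨S, rfl⟩ := iota_surjective p
  obtain ⟨T, rfl⟩ := iota_surjective q
  have hh := ProjTree.isJoinTree_chordalSup (K := K)
  exact ⟨iota '' geodesicSegment S T, hV _ hp _ hq _ ⟨S, T, rfl, rfl, rfl⟩,
    mem_image_of_mem _ (hh.left_mem_geodesicSegment S T),
    mem_image_of_mem _ (hh.right_mem_geodesicSegment S T),
    (hh.isPreconnected_geodesicSegment S T).image _ hτ.continuousOn⟩

theorem IsGeodesicallyConvex.joinedByArc {τ : TopologicalSpace (BerkLine K)}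
    (hτ : Continuous[_, τ] (iota (K := K))) (hτ2 : @T2Space _ τ)
    (hV : IsGeodesicallyConvex V) (hp : p ∈ V) (hq : q ∈ V) (hpq : p ≠ q) :
    JoinedByArc τ V p q := by
  obtain ⟨S, rfl⟩ := iota_surjective p
  obtain ⟨T, rfl⟩ := iota_surjective q
  obtain ⟨γ, hγ⟩ := ProjTree.isJoinTree_chordalSup.exists_isGeodesic S T
  refine ⟨fun t => iota (γ (dist S T * t)),
    hγ.isEmbedding_comp hτ2 hτ iota_injective (ne_of_apply_ne iota hpq), ?_, ?_, fun t => ?_⟩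
  · exact congrArg iota ((congrArg γ (mul_zero _)).trans hγ.left)
  · exact congrArg iota ((congrArg γ (mul_one _)).trans hγ.right)
  · refine isGeodesicallyConvex_iff.1 hV S T hp hq (mem_geodesicSegment.2 ⟨γ, hγ, _, ?_, rfl⟩)
    exact ⟨mul_nonneg dist_nonneg t.2.1, mul_le_of_le_one_right dist_nonneg t.2.2⟩

theorem isGeodesicallyConvex_of_isPreconnected (hV : IsPreconnected V) :
    IsGeodesicallyConvex V := by
  have hpre : @IsPreconnected _ ProjTree.weakTopology (iota ⁻¹' V) := by
    let _ : TopologicalSpace (ProjTree K) := ProjTree.weakTopology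
    rwa [← IsInducing.isPreconnected_image (f := iota) ⟨rfl⟩,
      image_preimage_eq V iota_surjective]
  exact isGeodesicallyConvex_iff.2 fun S T hS hT =>
    ProjTree.isJoinTree_chordalSup.geodesicSegment_subset_of_isPreconnected
      ProjTree.continuous_weakTopology_chordalSup hpre hS hT

theorem tfae_isGeodesicallyConvex_isPreconnected (V : Set (BerkLine K)) :
    List.TFAE [IsGeodesicallyConvex V, @IsPreconnected _ (fineTopology K) V,
      @IsPreconnected _ (weakTopology K) V] := by
  tfae_have 1 → 2 := IsGeodesicallyConvex.isPreconnected continuous_coinduced_rng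
  tfae_have 2 → 3 := isPreconnected_of_le fineTopology_le_weakTopology
  tfae_have 3 → 1 := isGeodesicallyConvex_of_isPreconnected
  tfae_finish

end Convex

end BerkovichLine

theorem mainTheorem10_general (K : Type*) [NormedField K] [IsUltrametricDist K]
    [BerkovichLine.AdmissibleField K] :
    (∀ (p q : BerkovichLine.BerkLine K) (ℓ : Set (BerkovichLine.BerkLine K)),
      BerkovichLine.IsSegment ℓ p q →
        TopologicalSpace.induced (Subtype.val : ℓ → BerkovichLine.BerkLine K)
            (BerkovichLine.weakTopology K) =
          TopologicalSpace.induced (Subtype.val : ℓ → BerkovichLine.BerkLine K)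
            (BerkovichLine.fineTopology K)) ∧
    (∀ V : Set (BerkovichLine.BerkLine K),
      List.TFAE [BerkovichLine.IsGeodesicallyConvex V,
        @IsPreconnected _ (BerkovichLine.fineTopology K) V,
        @IsPreconnected _ (BerkovichLine.weakTopology K) V]) ∧
    (∀ τ : TopologicalSpace (BerkovichLine.BerkLine K),
      τ = BerkovichLine.weakTopology K ∨ τ = BerkovichLine.fineTopology K →
        (∀ V : Set (BerkovichLine.BerkLine K), @IsPreconnected _ τ V →
          ∀ p ∈ V, ∀ q ∈ V, p ≠ q → BerkovichLine.JoinedByArc τ V p q) ∧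
        ∀ 𝒱 : Set (Set (BerkovichLine.BerkLine K)), (∀ V ∈ 𝒱, @IsPreconnected _ τ V) →
          @IsPreconnected _ τ (⋂₀ 𝒱)) := by
  have htfae := BerkovichLine.tfae_isGeodesicallyConvex_isPreconnected (K := K)
  refine ⟨fun p q ℓ hℓ => hℓ.induced_weakTopology_eq, htfae, fun τ hτ => ?_⟩
  obtain ⟨hcont, hT2, hconvex⟩ : @Continuous _ _ _ τ (BerkovichLine.iota (K := K)) ∧
      @T2Space _ τ ∧ ∀ V, @IsPreconnected _ τ V → BerkovichLine.IsGeodesicallyConvex V := by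
    rcases hτ with rfl | rfl
    · exact ⟨BerkovichLine.continuous_iota, inferInstance, fun V => ((htfae V).out 2 0).1⟩
    · exact ⟨continuous_coinduced_rng,
        t2Space_antitone BerkovichLine.fineTopology_le_weakTopology inferInstance,
        fun V => ((htfae V).out 1 0).1⟩
  exact ⟨fun V hV p hp q hq => (hconvex V hV).joinedByArc hcont hT2 hp hq, fun 𝒱 h𝒱 =>
    (BerkovichLine.isGeodesicallyConvex_sInter fun V hV =>
      hconvex V (h𝒱 V hV)).isPreconnected hcont⟩

theorem mainTheorem10 (K : Type*) [NormedField K] [IsUltrametricDist K] [CompleteSpace K]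
    [BerkovichLine.AdmissibleField K] :
    -- the two topologies agree on every geodesic segment
    (∀ (p q : BerkovichLine.BerkLine K) (ℓ : Set (BerkovichLine.BerkLine K)),
      BerkovichLine.IsSegment ℓ p q →
        TopologicalSpace.induced (Subtype.val : ℓ → BerkovichLine.BerkLine K)
            (BerkovichLine.weakTopology K) =
          TopologicalSpace.induced (Subtype.val : ℓ → BerkovichLine.BerkLine K)
            (BerkovichLine.fineTopology K)) ∧
    -- convexity and connectedness for each of the two topologies are equivalent
    (∀ V : Set (BerkovichLine.BerkLine K),
      List.TFAE [BerkovichLine.IsGeodesicallyConvex V,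
        @IsPreconnected _ (BerkovichLine.fineTopology K) V,
        @IsPreconnected _ (BerkovichLine.weakTopology K) V]) ∧
    -- for each of the two topologies, connected sets are arc-connected and intersections of
    -- connected sets are connected
    (∀ τ : TopologicalSpace (BerkovichLine.BerkLine K),
      τ = BerkovichLine.weakTopology K ∨ τ = BerkovichLine.fineTopology K →
        (∀ V : Set (BerkovichLine.BerkLine K), @IsPreconnected _ τ V →
          ∀ p ∈ V, ∀ q ∈ V, p ≠ q → BerkovichLine.JoinedByArc τ V p q) ∧
        ∀ 𝒱 : Set (Set (BerkovichLine.BerkLine K)), (∀ V ∈ 𝒱, @IsPreconnected _ τ V) →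
          @IsPreconnected _ τ (⋂₀ 𝒱)) :=
  mainTheorem10_general K
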